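/- Setting. Let $d\in\{2,3\}$ and let $p_0,p\ge 1$ be integers. For a $d$-tuple $\Xi=(\Xi_1,\dots,\Xi_d)$ of open knot vectors of degree $p$ on $[0,1]$ (internal knots of multiplicity at most $p$), $S_p(\Xi)$ is the tensor-product B-spline space, and the elements of the parametric mesh $\hat{\mathcal M}_0$ are the open boxes whose sides are intervals between consecutive distinct knots. Let $\mathbf F:(0,1)^d\to\Omega_0$ be a bi-Lipschitz spline map onto an open set $\Omega_0=\mathbf F((0,1)^d)\subset\mathbb R^d$, with components in $S_{p_0}(\Xi^0)$ for some $\Xi^0$. Let $\Omega_1$ be a bounded domain such that $\Omega=\Omega_0\setminus\overline{\Omega_1}$ is a Lipschitz domain, let $\mathbf n$ be its outward unit normal, $\Gamma_D\subseteq\partial\Omega$ measurable, $\hat\Omega=\mathbf F^{-1}(\Omega)$ and $\Gamma_{trim}=\partial\Omega\cap\partial\Omega_1$. The mesh $\mathcal M_h$ consists of the elements $K=\mathbf F(Q)$ with $Q\in\hat{\mathcal M}_0$, $Q\cap\hat\Omega\neq\emptyset$. Put $h_K=\operatorname{diam}K$, $\Gamma_K=\Gamma_D\cap\overline K$, $\mathcal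 G_h=\{K\in\mathcal M_h:\overline K\cap\Gamma_{trim}\ne\emptyset\}$, and let $\tilde V_h$ be the space of the functions $(\hat v\circ\mathbf F^{-1})|_\Omega$, $\hat v\in S_p(\Xi)$. Assumptions, with constants $\sigma,c_\Gamma,c_N$ and $\theta\in(0,1]$: $S_{p_0}(\Xi^0)\subseteq S_p(\Xi)$; for every $Q\in\hat{\mathcal M}_0$, $\mathbf F|_Q$ and $\mathbf F^{-1}|_{\mathbf F(Q)}$ are $C^\infty$ up to the boundary, and $\operatorname{diam}Q$ is at most $\sigma$ times each edge of $Q$; $|\Gamma_K|\le c_\Gamma h_K^{d-1}$ for all $K\in\mathcal M_h$. An element $K=\mathbf F(Q)\in\mathcal M_h$ is good if $|\hat\Omega\cap Q|\ge\theta|Q|$ and bad otherwise, and every bad $K$ has a good neighbour, i.e. a good $K'\in\mathcal M_h\setminus\{K\}$ with $\operatorname{dist}(K,K')\le c_N h_K$. For every bad $K$ such a $K'$ is chosen; for good $K$ put $K'=K$. Stabilization in the parametric domain. For $v_h\in\tilde V_h$ and $K=\mathbf F(Q)\in\mathcal G_h$, with $Q'=\mathbf F^{-1}(K')$ and $\hat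 v_h=v_h\circ\mathbf F$, define $R_h(v_h)$ on $\Gamma_K$ as $$R_K(v_h)=\frac{\partial (v_h|_K)}{\partial n}\ \text{ if } K \text{ is good},\qquad R_K(v_h)=\frac{\partial\big(\mathcal E(\hat v_h|_{Q'})\circ\mathbf F^{-1}|_K\big)}{\partial n}\ \text{ if } K \text{ is bad},$$ where $\mathcal E(\hat v_h|_{Q'})$ is the extension to $Q$ of the polynomial (of degree at most $p$ in each variable) with which $\hat v_h$ coincides on $Q'$. On $\overline K$, $v_h|_K$ is the full spline piece of the element, and gradients are continuously extended from $K$. Theorem. There is a constant $C>0$, depending only on $d,p_0,p,\Xi^0,\mathbf F,\sigma,c_\Gamma,c_N,\theta$, such that for all $\Xi$, $\Omega_1$, $\Gamma_D$ and all choices of good neighbours as above, every $K\in\mathcal G_h$ and every $v_h\in\tilde V_h$, one has $R_K(v_h)\in L^2(\Gamma_K)$ and $$\big\|h_K^{1/2}R_K(v_h)\big\|_{L^2(\Gamma_K)}\le C\,\|\nabla v_h\|_{L^2(\Omega\cap K')}.$$ In particular $C$ does not depend on the mesh size or on the trimming configuration. -/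

import Mathlib

open MeasureTheory Set Topology
open scoped NNReal ENNReal ContDiff

namespace TrimmedIGA

/-- Points of `ℝ^d`, with the Euclidean norm. -/
abbrev Pt (d : ℕ) := EuclideanSpace ℝ (Fin d)

/-! ### Univariate and multivariate B-splines -/

/-- A `p`-open knot vector on `[0,1]` with `n + p + 1` knots (numbered from `0` to `n + p`):
`0 = ξ₀ = ⋯ = ξ_p < ξ_{p+1} ≤ ⋯ ≤ ξ_{n-1} < ξ_n = ⋯ = ξ_{n+p} = 1`, in which every internal knot
has multiplicity at most `p`. The values `knot i` for `i > n + p` play no role. -/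
structure KnotVector (p : ℕ) where
  n : ℕ
  knot : ℕ → ℝ
  mono : ∀ i j, i ≤ j → j ≤ n + p → knot i ≤ knot j
  left : ∀ i, i ≤ p → knot i = 0
  left_lt : 0 < knot (p + 1)
  right : ∀ i, n ≤ i → i ≤ n + p → knot i = 1
  right_lt : knot (n - 1) < 1
  mult : ∀ t : ℝ, 0 < t → t < 1 →
    ((Finset.range (n + p + 1)).filter (fun i => knot i = t)).card ≤ p

open Classical in
/-- The Cox-de Boor recursion on `[0,1]`, with the convention `0 / 0 = 0`: `coxDeBoor ξ q i` is the
`i`-th B-spline of degree `q`. The last non-empty knot span is closed at the right end point `1`. -/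
noncomputable def coxDeBoor (ξ : ℕ → ℝ) : ℕ → ℕ → ℝ → ℝ
  | 0, i, x =>
      if ξ i ≤ x ∧ (x < ξ (i + 1) ∨ (x = 1 ∧ ξ i < 1 ∧ ξ (i + 1) = 1)) then 1 else 0
  | q + 1, i, x =>
      (x - ξ i) / (ξ (i + q + 1) - ξ i) * coxDeBoor ξ q i x
        + (ξ (i + q + 2) - x) / (ξ (i + q + 2) - ξ (i + 1)) * coxDeBoor ξ q (i + 1) x

/-- The multivariate B-spline with multi-index `i`. -/
noncomputable def tensorBSpline {d p : ℕ} (Ξ : Fin d → KnotVector p) (i : Fin d → ℕ) (x : Pt d) :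
    ℝ :=
  ∏ l, coxDeBoor (Ξ l).knot p (i l) (x l)

/-- The spline space `S_p(Ξ)`; its elements are regarded as functions on `[0,1]^d`, extended by zero
to `ℝ^d`. -/
noncomputable def splineSpace {d p : ℕ} (Ξ : Fin d → KnotVector p) : Submodule ℝ (Pt d → ℝ) :=
  Submodule.span ℝ {f | ∃ i : Fin d → ℕ, (∀ l, i l < (Ξ l).n) ∧ f = tensorBSpline Ξ i}

/-! ### The parametric mesh -/

/-- The parametric domain `(0,1)^d`. -/
def cube (d : ℕ) : Set (Pt d) := {x | ∀ l, 0 < x l ∧ x l < 1}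

/-- `i` selects, in each direction `l`, a non-empty knot span `(ξ_{i l}, ξ_{i l + 1})`, that is, an
interval between two consecutive breakpoints. -/
def IsSpan {d p : ℕ} (Ξ : Fin d → KnotVector p) (i : Fin d → ℕ) : Prop :=
  ∀ l, i l + 1 ≤ (Ξ l).n + p ∧ (Ξ l).knot (i l) < (Ξ l).knot (i l + 1)

/-- The open box with the knot spans selected by `i` as its sides. -/
def cell {d p : ℕ} (Ξ : Fin d → KnotVector p) (i : Fin d → ℕ) : Set (Pt d) :=
  {x | ∀ l, (Ξ l).knot (i l) < x l ∧ x l < (Ξ l).knot (i l + 1)}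

/-- The parametric Bézier mesh of the untrimmed domain. -/
def bezierMesh {d p : ℕ} (Ξ : Fin d → KnotVector p) : Set (Set (Pt d)) :=
  {Q | ∃ i, IsSpan Ξ i ∧ Q = cell Ξ i}

/-- Shape regularity with constant `σ`: the diameter of an element is at most `σ` times each of its
edges. -/
def ShapeRegular {d p : ℕ} (σ : ℝ) (Ξ : Fin d → KnotVector p) : Prop :=
  ∀ i, IsSpan Ξ i → ∀ l,
    Metric.diam (cell Ξ i) ≤ σ * ((Ξ l).knot (i l + 1) - (Ξ l).knot (i l))

/-! ### The parametrization -/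

/-- The inverse of `F : (0,1)^d → F((0,1)^d)`. -/
noncomputable def paramInv {d : ℕ} (F : Pt d → Pt d) : Pt d → Pt d :=
  Function.invFunOn F (cube d)

/-- `F : (0,1)^d → Ω₀` is a bi-Lipschitz spline map onto an open set `Ω₀ = F((0,1)^d)`. -/
structure IsParametrization {d p₀ : ℕ} (Ξ₀ : Fin d → KnotVector p₀) (F : Pt d → Pt d) : Prop where
  spline : ∀ j, (fun x => F x j) ∈ splineSpace Ξ₀
  isOpen_image : IsOpen (F '' cube d)
  biLipschitz : ∃ c₁ c₂ : ℝ, 0 < c₁ ∧ 0 < c₂ ∧ ∀ x ∈ cube d, ∀ y ∈ cube d,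
    c₁ * dist x y ≤ dist (F x) (F y) ∧ dist (F x) (F y) ≤ c₂ * dist x y

/-- `g`, given on the open set `U`, extends to a `C^∞` map on the closure of `U`. -/
def SmoothUpToBoundary {d : ℕ} (g : Pt d → Pt d) (U : Set (Pt d)) : Prop :=
  ∃ G : Pt d → Pt d, ContDiffOn ℝ ∞ G (closure U) ∧ EqOn G g U

/-- On the closure of every element, `F` and its inverse are `C^∞`. -/
def ElementwiseSmooth {d p : ℕ} (F : Pt d → Pt d) (Ξ : Fin d → KnotVector p) : Prop :=
  ∀ Q ∈ bezierMesh Ξ, SmoothUpToBoundary F Q ∧ SmoothUpToBoundary (paramInv F) (F '' Q)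

/-! ### The trimmed domain -/

/-- A (strongly) Lipschitz domain: near each boundary point the open set `Ω` is the region below the
graph of a Lipschitz function, in a suitable direction `e`. -/
def IsLipschitzDomain {d : ℕ} (Ω : Set (Pt d)) : Prop :=
  IsOpen Ω ∧ Bornology.IsBounded Ω ∧
    ∀ x ∈ frontier Ω, ∃ (e : Pt d) (L : ℝ≥0) (φ : Pt d → ℝ) (r : ℝ),
      ‖e‖ = 1 ∧ LipschitzWith L φ ∧ 0 < r ∧
        ∀ y ∈ Metric.ball x r, y ∈ Ω ↔ inner ℝ y e < φ (y - (inner ℝ y e) • e)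

/-- `ν` is an outward unit normal to `Ω` at `x`: in the blow-up at `x`, the set `Ω` becomes the half
space `{w | ⟪w, ν⟫ < 0}`. There is at most one such `ν`; where the boundary is near `x` a graph, this
says that the function is differentiable at the point, and that `ν` is the usual normal. -/
def IsOutwardNormal {d : ℕ} (Ω : Set (Pt d)) (x ν : Pt d) : Prop :=
  ‖ν‖ = 1 ∧ ∀ ε : ℝ, 0 < ε → ∃ δ : ℝ, 0 < δ ∧ ∀ y ∈ Metric.ball x δ,
    (y ∈ Ω → inner ℝ (y - x) ν ≤ ε * ‖y - x‖) ∧ (y ∉ Ω → -(ε * ‖y - x‖) ≤ inner ℝ (y - x) ν)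

open Classical in
/-- The outward unit normal field. For a Lipschitz domain it exists almost everywhere on the
boundary; it is set to zero elsewhere. -/
noncomputable def outwardNormal {d : ℕ} (Ω : Set (Pt d)) (x : Pt d) : Pt d :=
  if h : ∃ ν, IsOutwardNormal Ω x ν then h.choose else 0

/-- The domain `F((0,1)^d) \ closure Ω₁`. -/
def trimmedDomain {d : ℕ} (F : Pt d → Pt d) (Ω₁ : Set (Pt d)) : Set (Pt d) :=
  (F '' cube d) \ closure Ω₁

/-- The pull-back of `Ω` to the parametric domain. -/
def pullback {d : ℕ} (F : Pt d → Pt d) (Ω : Set (Pt d)) : Set (Pt d) :=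
  {x | x ∈ cube d ∧ F x ∈ Ω}

/-- The parametric Bézier elements that meet the pull-back of `Ω`. The physical element of `Q` is
`F '' Q`. -/
def activeMesh {d p : ℕ} (F : Pt d → Pt d) (Ξ : Fin d → KnotVector p) (Ω : Set (Pt d)) :
    Set (Set (Pt d)) :=
  {Q | Q ∈ bezierMesh Ξ ∧ (Q ∩ pullback F Ω).Nonempty}

/-- The (parametric) elements whose physical element is cut by the trimming curve
`∂Ω ∩ ∂Ω₁`. -/
def cutMesh {d p : ℕ} (F : Pt d → Pt d) (Ξ : Fin d → KnotVector p) (Ω Ω₁ : Set (Pt d)) :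
    Set (Set (Pt d)) :=
  {Q | Q ∈ activeMesh F Ξ Ω ∧ (closure (F '' Q) ∩ (frontier Ω ∩ frontier Ω₁)).Nonempty}

/-- The part of the Dirichlet boundary in the closure of the physical element of `Q`. -/
def dirichletPart {d : ℕ} (F : Pt d → Pt d) (ΓD Q : Set (Pt d)) : Set (Pt d) :=
  ΓD ∩ closure (F '' Q)

/-- The surface measure of the Dirichlet part of each element is at most `cΓ h_K^(d-1)`, where
`h_K` is the diameter of the physical element `K`. -/
def BoundedDirichletParts {d p : ℕ} (cΓ : ℝ) (F : Pt d → Pt d) (Ξ : Fin d → KnotVector p)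
    (Ω ΓD : Set (Pt d)) : Prop :=
  ∀ Q ∈ activeMesh F Ξ Ω, (dirichletPart F ΓD Q).Nonempty →
    μHE[d - 1] (dirichletPart F ΓD Q) ≤ ENNReal.ofReal (cΓ * Metric.diam (F '' Q) ^ (d - 1))

/-- A good element: the fraction of `Q` inside the pull-back of `Ω` is at least `θ`. -/
def IsGood {d : ℕ} (θ : ℝ) (F : Pt d → Pt d) (Ω Q : Set (Pt d)) : Prop :=
  θ ≤ volume.real (pullback F Ω ∩ Q) / volume.real Q

/-- The distance `inf {dist a b | a ∈ A, b ∈ B}` of two sets. -/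
noncomputable def setDist {d : ℕ} (A B : Set (Pt d)) : ℝ :=
  sInf {r | ∃ a ∈ A, ∃ b ∈ B, r = dist a b}

/-- `Q'` is a neighbour of `Q`: a different active element, such that the distance of the physical
elements is at most `cN` times the diameter of the physical element of `Q`. -/
def IsNeighbour {d p : ℕ} (cN : ℝ) (F : Pt d → Pt d) (Ξ : Fin d → KnotVector p)
    (Ω Q Q' : Set (Pt d)) : Prop :=
  Q' ∈ activeMesh F Ξ Ω ∧ Q' ≠ Q ∧ setDist (F '' Q) (F '' Q') ≤ cN * Metric.diam (F '' Q)

/-- `s` assigns to every bad element one of its good neighbours. -/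
def IsGoodNeighbourChoice {d p : ℕ} (cN θ : ℝ) (F : Pt d → Pt d) (Ξ : Fin d → KnotVector p)
    (Ω : Set (Pt d)) (s : Set (Pt d) → Set (Pt d)) : Prop :=
  ∀ Q ∈ activeMesh F Ξ Ω, ¬ IsGood θ F Ω Q →
    IsNeighbour cN F Ξ Ω Q (s Q) ∧ IsGood θ F Ω (s Q)

open Classical in
/-- The element `Q'` that goes with `Q`: `Q` itself if it is good, the chosen good neighbour if it is
bad. -/
noncomputable def donor {d : ℕ} (θ : ℝ) (F : Pt d → Pt d) (Ω : Set (Pt d))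
    (s : Set (Pt d) → Set (Pt d)) (Q : Set (Pt d)) : Set (Pt d) :=
  if IsGood θ F Ω Q then Q else s Q

/-! ### The discrete space and the stabilized normal derivative -/

/-- The discrete space on the trimmed domain: the span of the restrictions to `Ω` of the pushed
forward B-splines. Functions on `Ω` are represented by their extension by zero to `ℝ^d`. -/
noncomputable def trimmedSpace {d p : ℕ} (F : Pt d → Pt d) (Ξ : Fin d → KnotVector p)
    (Ω : Set (Pt d)) : Submodule ℝ (Pt d → ℝ) :=
  Submodule.span ℝ {f | ∃ i : Fin d → ℕ, (∀ l, i l < (Ξ l).n) ∧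
    f = Ω.indicator (fun x => tensorBSpline Ξ i (paramInv F x))}

/-- The function on `ℝ^d` given by a polynomial in `d` variables. -/
noncomputable def polyFun {d : ℕ} (P : MvPolynomial (Fin d) ℝ) (x : Pt d) : ℝ :=
  MvPolynomial.eval (fun l => x l) P

open Classical in
/-- The polynomial of degree at most `p` in each variable that agrees with `w` on `A` (zero if there
is none); it is unique if `A` has non-empty interior. -/
noncomputable def polyExtension {d : ℕ} (p : ℕ) (A : Set (Pt d)) (w : Pt d → ℝ) :
    MvPolynomial (Fin d) ℝ :=
  if h : ∃ P ∈ MvPolynomial.restrictDegree (Fin d) ℝ p, ∀ x ∈ A, polyFun P x = w x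
  then h.choose else 0

/-- The normal derivative on the closure of the physical element `K` of a function `u` on `K`. The
gradient is extended continuously from the open set `K` to its closure. -/
noncomputable def normalDeriv {d : ℕ} (Ω K : Set (Pt d)) (u : Pt d → ℝ) (x : Pt d) : ℝ :=
  inner ℝ (extendFrom K (gradient u) x) (outwardNormal Ω x)

/-- The stabilized normal derivative `R_K(v)` on the physical element `K = F(Q)`. Let `Q'` be the
donor of `Q`. The pull-back `v ∘ F` is on `Q'` a polynomial, which is extended to `Q` and pushed
forward to `K` by `F⁻¹`. If `Q` is good, then `Q' = Q`, the extension is trivial, the function pushed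
forward is the piece `v|_K`, and `R_K(v)` is its normal derivative. Since `v` is a function on `Ω`,
its polynomial piece on `Q'` is read off from the part of `Q'` inside the pull-back of `Ω`. -/
noncomputable def stabilizedFlux {d : ℕ} (p : ℕ) (θ : ℝ) (F : Pt d → Pt d) (Ω : Set (Pt d))
    (s : Set (Pt d) → Set (Pt d)) (v : Pt d → ℝ) (Q : Set (Pt d)) : Pt d → ℝ :=
  normalDeriv Ω (F '' Q) (fun y =>
    polyFun (polyExtension p (pullback F Ω ∩ donor θ F Ω s Q) (fun x => v (F x))) (paramInv F y))

end TrimmedIGA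

open TrimmedIGA

namespace TrimmedIGA

/-! ### Polynomials in several real variables -/

/-! The estimate compares two numbers through one pointwise quantity, the maximum `B` of the
gradient over the closure of `Q` of the polynomial `P` that represents `v ∘ F` on the part `A` of
the donor inside the pull-back of `Ω`. With `h` the diameter of the donor, the flux norm is at most
a constant times `B * √(h ^ d)`, and the norm of the gradient of `v` on the donor is at least a
constant times the same quantity.

The upper bound is direct: the inverse of `F` is Lipschitz, so the flux is at most `B * c₁⁻¹`, and
the factor `h_K^(1/2)` completes the surface measure bound `h_K^(d-1)` to `h_K^d`.

The lower bound must hold however `A` sits inside the donor. A nonzero polynomial has a null zero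
set, and by compactness of the unit sphere of coefficients, polynomials of bounded degree are
uniformly not small except on a set of small measure (`exists_volume_sublevel_unitBall_le`).
Rescaling gives `exists_volume_superlevel_ge`: on a fixed fraction of `A`, the polynomial is at
least `ε` times its value at any point within `M * h`. Applied to the derivative of `P` along its
own gradient at the maximum point, this bounds the gradient of `v` from below on a set of measure
comparable to `h ^ d` (`ofReal_norm_gradient_le_eLpNorm`).

The maximum point is within `M * h` of the donor because neighbours are close and because shape
regularity of a tensor-product mesh forces quasi-uniformity (`ShapeRegular.diam_le`). Smoothness of
`F` on elements enters only qualitatively; the constants come from its bi-Lipschitz bounds. -/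

theorem volume_mvPolynomial_zeroSet : ∀ (n : ℕ) (P : MvPolynomial (Fin n) ℝ), P ≠ 0 →
    volume {x : Fin n → ℝ | MvPolynomial.eval x P = 0} = 0
  | 0, P, hP => by
    obtain ⟨c, rfl⟩ := MvPolynomial.C_surjective (Fin 0) P
    have hc : c ≠ 0 := by rintro rfl; simp at hP
    simp [hc]
  | n + 1, P, hP => by
    have hcont : Continuous fun x : Fin (n + 1) → ℝ => MvPolynomial.eval x P :=
      MvPolynomial.continuous_eval P
    -- View `P` as a polynomial in the first variable. Off the null set where its leading
    -- coefficient vanishes, every slice of the zero set is finite, and Tonelli concludes.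
    have hP' : MvPolynomial.finSuccEquiv ℝ n P ≠ 0 := by simpa using hP
    have hlead := volume_mvPolynomial_zeroSet n _ (Polynomial.leadingCoeff_ne_zero.2 hP')
    have e := (volume_preserving_piFinSuccAbove (fun _ : Fin (n + 1) => ℝ) 0).symm
    have hm : MeasurableSet {x : Fin (n + 1) → ℝ | MvPolynomial.eval x P = 0} :=
      (isClosed_eq hcont continuous_const).measurableSet
    rw [← e.measure_preimage hm.nullMeasurableSet, Measure.volume_eq_prod,
      Measure.prod_apply_symm (e.measurable hm)]
    rw [lintegral_eq_zero_iff' (by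
      exact (measurable_measure_prodMk_right (e.measurable hm)).aemeasurable)]
    filter_upwards [measure_eq_zero_iff_ae_notMem.1 hlead] with s hs
    have hs' : (MvPolynomial.finSuccEquiv ℝ n P).map (MvPolynomial.eval s) ≠ 0 := by
      intro h0
      apply hs
      have := congrArg (fun q => Polynomial.coeff q (MvPolynomial.finSuccEquiv ℝ n P).natDegree) h0
      simpa using this
    refine (Set.Finite.subset (Polynomial.finite_setOfPred_isRoot hs') ?_).measure_zero _
    intro y hy
    have : MvPolynomial.eval (Fin.cons y s : Fin (n + 1) → ℝ) P = 0 := by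
      simpa [MeasurableEquiv.piFinSuccAbove, Fin.insertNthEquiv] using hy
    rwa [MvPolynomial.eval_eq_eval_mv_eval'] at this

variable {d : ℕ}

theorem continuous_polyFun (P : MvPolynomial (Fin d) ℝ) : Continuous (polyFun P) := by
  unfold polyFun
  exact (MvPolynomial.continuous_eval P).comp (by fun_prop)

theorem volume_polyFun_zeroSet {P : MvPolynomial (Fin d) ℝ} (hP : P ≠ 0) :
    volume {x : Pt d | polyFun P x = 0} = 0 := by
  have hm : MeasurableSet {x : Fin d → ℝ | MvPolynomial.eval x P = 0} :=
    (isClosed_eq (MvPolynomial.continuous_eval P) continuous_const).measurableSet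
  have := (PiLp.volume_preserving_ofLp (Fin d)).measure_preimage hm.nullMeasurableSet
  rw [volume_mvPolynomial_zeroSet d P hP] at this
  exact this

theorem hasFDerivAt_polyFun (P : MvPolynomial (Fin d) ℝ) (y : Pt d) :
    HasFDerivAt (polyFun P)
      (∑ j, polyFun (MvPolynomial.pderiv j P) y • (EuclideanSpace.proj j : Pt d →L[ℝ] ℝ)) y := by
  induction P using MvPolynomial.induction_on with
  | C a =>
    have : polyFun (MvPolynomial.C a : MvPolynomial (Fin d) ℝ) = fun _ => a := by
      ext; simp [polyFun]
    rw [this]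
    simpa [polyFun] using hasFDerivAt_const a y
  | add P Q hP hQ =>
    have : polyFun (P + Q) = fun x => polyFun P x + polyFun Q x := by ext; simp [polyFun]
    rw [this]
    refine (hP.fun_add hQ).congr_fderiv ?_
    simp [polyFun, add_smul, Finset.sum_add_distrib]
  | mul_X P i hP =>
    have : polyFun (P * MvPolynomial.X i) = fun x => polyFun P x * x i := by ext; simp [polyFun]
    rw [this]
    refine (hP.fun_mul (EuclideanSpace.proj i : Pt d →L[ℝ] ℝ).hasFDerivAt).congr_fderiv ?_
    ext w
    simp only [polyFun, Derivation.leibniz, MvPolynomial.pderiv_X, smul_eq_mul, map_add, map_mul,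
      MvPolynomial.eval_X, Pi.single_apply, apply_ite (MvPolynomial.eval _), map_zero,
      FunLike.coe_add, FunLike.coe_smul, sum_apply, Pi.add_apply, Pi.smul_apply,
      PiLp.proj_apply, add_mul, Finset.sum_add_distrib, Finset.mul_sum, mul_ite, mul_one, mul_zero,
      ite_mul, zero_mul, Finset.sum_ite_eq, Finset.mem_univ, if_true, mul_assoc]

/-- The derivative of a polynomial in the direction `w`. -/
noncomputable def polyDirDeriv (P : MvPolynomial (Fin d) ℝ) (w : Pt d) : MvPolynomial (Fin d) ℝ :=
  ∑ j, MvPolynomial.C (w j) * MvPolynomial.pderiv j P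

theorem polyFun_polyDirDeriv (P : MvPolynomial (Fin d) ℝ) (w y : Pt d) :
    polyFun (polyDirDeriv P w) y = fderiv ℝ (polyFun P) y w := by
  rw [(hasFDerivAt_polyFun P y).fderiv]
  simp [polyFun, polyDirDeriv, mul_comm]

theorem totalDegree_pderiv_le (P : MvPolynomial (Fin d) ℝ) (j : Fin d) :
    (MvPolynomial.pderiv j P).totalDegree ≤ P.totalDegree := by
  conv_lhs => rw [P.as_sum, map_sum]
  refine MvPolynomial.totalDegree_finsetSum_le fun s hs => ?_
  rw [MvPolynomial.pderiv_monomial]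
  refine (MvPolynomial.totalDegree_monomial_le _ _).trans ?_
  refine le_trans ?_ (MvPolynomial.le_totalDegree hs)
  exact Finsupp.sum_le_sum_index tsub_le_self (fun _ _ => monotone_id) (fun _ _ => rfl)

theorem totalDegree_polyDirDeriv_le (P : MvPolynomial (Fin d) ℝ) (w : Pt d) :
    (polyDirDeriv P w).totalDegree ≤ P.totalDegree := by
  refine MvPolynomial.totalDegree_finsetSum_le fun j _ => ?_
  rw [← MvPolynomial.smul_eq_C_mul]
  exact (MvPolynomial.totalDegree_smul_le _ _).trans (totalDegree_pderiv_le P j)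

theorem totalDegree_le_of_mem_restrictDegree {p : ℕ} {P : MvPolynomial (Fin d) ℝ}
    (hP : P ∈ MvPolynomial.restrictDegree (Fin d) ℝ p) : P.totalDegree ≤ d * p := by
  rw [MvPolynomial.mem_restrictDegree] at hP
  refine Finset.sup_le fun s hs => ?_
  rw [Finsupp.sum_fintype _ _ (fun _ => rfl)]
  calc ∑ i, s i ≤ ∑ _i : Fin d, p := Finset.sum_le_sum fun i _ => hP s hs i
    _ = d * p := by simp

/-- The polynomial `z ↦ P (x₀ + h z)`. -/
noncomputable def polyRescale (P : MvPolynomial (Fin d) ℝ) (x₀ : Pt d) (h : ℝ) :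
    MvPolynomial (Fin d) ℝ :=
  MvPolynomial.bind₁ (fun l => MvPolynomial.C (x₀ l) + MvPolynomial.C h * MvPolynomial.X l) P

theorem polyFun_polyRescale (P : MvPolynomial (Fin d) ℝ) (x₀ z : Pt d) (h : ℝ) :
    polyFun (polyRescale P x₀ h) z = polyFun P (x₀ + h • z) := by
  simp only [polyFun, polyRescale, MvPolynomial.bind₁, MvPolynomial.aeval_def]
  rw [MvPolynomial.eval₂_eq', map_sum, MvPolynomial.eval_eq']
  simp

theorem totalDegree_polyRescale_le (P : MvPolynomial (Fin d) ℝ) (x₀ : Pt d) (h : ℝ) :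
    (polyRescale P x₀ h).totalDegree ≤ P.totalDegree := by
  simp only [polyRescale, MvPolynomial.bind₁, MvPolynomial.aeval_def]
  rw [MvPolynomial.eval₂_eq']
  refine MvPolynomial.totalDegree_finsetSum_le fun s hs => ?_
  rw [MvPolynomial.algebraMap_eq, ← MvPolynomial.smul_eq_C_mul]
  refine (MvPolynomial.totalDegree_smul_le _ _).trans ?_
  refine (MvPolynomial.totalDegree_finsetProd _ _).trans ?_
  refine le_trans ?_ (MvPolynomial.le_totalDegree hs)
  rw [Finsupp.sum_fintype _ _ (fun _ => rfl)]
  refine Finset.sum_le_sum fun i _ => ?_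
  refine (MvPolynomial.totalDegree_pow _ _).trans ?_
  refine (Nat.mul_le_mul_left _ (?_ : _ ≤ 1)).trans_eq (mul_one _)
  refine (MvPolynomial.totalDegree_add _ _).trans (max_le (by simp) ?_)
  rw [← MvPolynomial.smul_eq_C_mul]
  exact (MvPolynomial.totalDegree_smul_le _ _).trans (by simp)

/-- Polynomials of bounded degree are small on a small part of the unit ball only, relative to their
values on a larger ball. -/
theorem exists_volume_sublevel_unitBall_le (n : ℕ) (M : ℝ) {τ : ℝ≥0∞} (hτ : 0 < τ) :
    ∃ ε : ℝ, 0 < ε ∧ ∀ P : MvPolynomial (Fin d) ℝ, P.totalDegree ≤ n →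
      ∀ x ∈ Metric.closedBall (0 : Pt d) M, polyFun P x ≠ 0 →
        volume {y ∈ Metric.closedBall (0 : Pt d) 1 | |polyFun P y| ≤ ε * |polyFun P x|} ≤ τ := by
  let V := MvPolynomial.restrictTotalDegree (Fin d) ℝ n
  let b := Module.finBasis ℝ V
  let k := Module.finrank ℝ V
  let q : (Fin k → ℝ) → Pt d → ℝ := fun c y => ∑ i, c i * polyFun (b i : MvPolynomial (Fin d) ℝ) y
  have hbound : ∀ r : ℝ, ∃ R : ℝ, 0 < R ∧ ∀ y ∈ Metric.closedBall (0 : Pt d) r,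
      ∑ i, |polyFun (b i : MvPolynomial (Fin d) ℝ) y| ≤ R := by
    intro r
    have hc : Continuous fun y : Pt d => ∑ i, |polyFun (b i : MvPolynomial (Fin d) ℝ) y| :=
      continuous_finsetSum _ fun i _ => (continuous_polyFun _).abs
    obtain ⟨R, hR⟩ := (isCompact_closedBall (0 : Pt d) r).bddAbove_image hc.continuousOn
    exact ⟨max R 1, by positivity, fun y hy => (hR ⟨y, hy, rfl⟩).trans (le_max_left _ _)⟩
  have hq : ∀ c y, |q c y| ≤ ‖c‖ * ∑ i, |polyFun (b i : MvPolynomial (Fin d) ℝ) y| := by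
    intro c y
    rw [Finset.mul_sum]
    refine (Finset.abs_sum_le_sum_abs _ _).trans (Finset.sum_le_sum fun i _ => ?_)
    rw [abs_mul]
    exact mul_le_mul_of_nonneg_right (norm_le_pi_norm c i) (abs_nonneg _)
  have hqP : ∀ c, q c = polyFun ((∑ i, c i • b i : V) : MvPolynomial (Fin d) ℝ) := by
    intro c; ext y
    simp [q, polyFun, MvPolynomial.smul_eval]
  have hqsub : ∀ c c' y, q c y - q c' y = q (c - c') y := by
    intro c c' y
    simp [q, sub_mul]
  obtain ⟨R₁, hR₁, hR₁'⟩ := hbound 1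
  obtain ⟨R, hR, hR'⟩ := hbound M
  -- By homogeneity, coefficient vectors of norm one suffice. On their compact sphere a locally
  -- valid `ε` becomes uniform by taking minima.
  have key : ∃ ε : ℝ, 0 < ε ∧ ∀ c ∈ Metric.sphere (0 : Fin k → ℝ) 1,
      volume {y ∈ Metric.closedBall (0 : Pt d) 1 | |q c y| ≤ ε} ≤ τ := by
    refine (isCompact_sphere (0 : Fin k → ℝ) 1).induction_on
      (p := fun s => ∃ ε : ℝ, 0 < ε ∧ ∀ c ∈ s,
        volume {y ∈ Metric.closedBall (0 : Pt d) 1 | |q c y| ≤ ε} ≤ τ) ⟨1, one_pos, by simp⟩ ?_ ?_ ?_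
    · rintro s t hst ⟨ε, hε, h⟩
      exact ⟨ε, hε, fun c hc => h c (hst hc)⟩
    · rintro s t ⟨ε, hε, h⟩ ⟨ε', hε', h'⟩
      refine ⟨min ε ε', lt_min hε hε', ?_⟩
      rintro c (hc | hc)
      · exact (measure_mono (by
          rintro y ⟨hy, hy'⟩; exact ⟨hy, hy'.trans (min_le_left _ _)⟩)).trans (h c hc)
      · exact (measure_mono (by
          rintro y ⟨hy, hy'⟩; exact ⟨hy, hy'.trans (min_le_right _ _)⟩)).trans (h' c hc)
    · intro c hc
      have hc0 : c ≠ 0 := by rintro rfl; simp at hc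
      have hne : ((∑ i, c i • b i : V) : MvPolynomial (Fin d) ℝ) ≠ 0 := by
        intro h0
        apply hc0
        have h1 : (∑ i, c i • b i : V) = 0 := Subtype.ext h0
        ext i
        exact Fintype.linearIndependent_iff.1 b.linearIndependent c h1 i
      -- The sublevel sets of one fixed nonzero polynomial decrease to its null zero set, so one of
      -- them has measure below `τ`.
      let E : ℕ → Set (Pt d) := fun m =>
        {y ∈ Metric.closedBall (0 : Pt d) 1 | |q c y| ≤ 1 / ((m : ℝ) + 1)}
      have hqc : Continuous (q c) := by rw [hqP]; exact continuous_polyFun _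
      have hEm : ∀ m, MeasurableSet (E m) := fun m =>
        (IsClosed.inter (s₁ := Metric.closedBall (0 : Pt d) 1) Metric.isClosed_closedBall
          (isClosed_le hqc.abs continuous_const)).measurableSet
      have hEanti : Antitone E := fun m m' hmm y hy =>
        ⟨hy.1, hy.2.trans (Nat.one_div_le_one_div hmm)⟩
      have hfin : volume (E 0) ≠ ⊤ :=
        ((measure_mono (show E 0 ⊆ Metric.closedBall (0 : Pt d) 1 from fun y hy => hy.1)).trans_lt
          measure_closedBall_lt_top).ne
      have hlim := tendsto_measure_iInter_atTop (fun m => (hEm m).nullMeasurableSet) hEanti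
        ⟨0, hfin⟩
      have hzero : volume (⋂ m, E m) = 0 := by
        refine measure_mono_null ?_ (volume_polyFun_zeroSet hne)
        intro y hy
        rw [← hqP]
        have h2 : |q c y| ≤ 0 := ge_of_tendsto' tendsto_one_div_add_atTop_nhds_zero_nat
          fun m => (mem_iInter.1 hy m).2
        exact abs_nonpos_iff.1 h2
      rw [hzero] at hlim
      obtain ⟨m, hm⟩ := (hlim.eventually (gt_mem_nhds hτ)).exists
      have hδ : (0 : ℝ) < 1 / ((m : ℝ) + 1) := by positivity
      set δ : ℝ := 1 / ((m : ℝ) + 1) with hδdef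
      -- In this ball of coefficients, values on the unit ball change by at most `δ / 2`, so the `δ
      -- / 2` sublevel set of `c'` lies in the `δ` sublevel set of `c`.
      refine ⟨Metric.ball c (δ / 2 / R₁), mem_nhdsWithin_of_mem_nhds
        (Metric.ball_mem_nhds _ (by positivity)), δ / 2, by positivity, ?_⟩
      intro c' hc'
      refine (measure_mono ?_).trans hm.le
      rintro y ⟨hy, hy'⟩
      refine ⟨hy, ?_⟩
      have h1 : |q c y - q c' y| ≤ δ / 2 := by
        rw [hqsub]
        refine (hq _ _).trans ((mul_le_mul_of_nonneg_left (hR₁' y hy) (norm_nonneg _)).trans ?_)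
        rw [Metric.mem_ball', dist_eq_norm] at hc'
        exact ((lt_div_iff₀ hR₁).1 hc').le
      have h2 := abs_sub_abs_le_abs_sub (q c y) (q c' y)
      linarith
  obtain ⟨ε, hε, hε'⟩ := key
  -- Since `|polyFun P x| ≤ ‖c‖ * R`, dividing by `‖c‖` turns the threshold into one that is at most
  -- `ε`.
  refine ⟨ε / R, by positivity, fun P hP x hx hPx => ?_⟩
  let P' : V := ⟨P, (MvPolynomial.mem_restrictTotalDegree _ _ _).2 hP⟩
  let c : Fin k → ℝ := b.repr P'
  have hcP : q c = polyFun P := by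
    rw [hqP]; exact congrArg polyFun (congrArg Subtype.val (b.sum_repr P'))
  have hxc : |polyFun P x| ≤ ‖c‖ * R := by
    rw [← hcP]
    exact (hq c x).trans (mul_le_mul_of_nonneg_left (hR' x hx) (norm_nonneg _))
  have hc : 0 < ‖c‖ := by
    rcases (norm_nonneg c).eq_or_lt with h | h
    · rw [← h, zero_mul] at hxc
      exact absurd (abs_nonpos_iff.1 hxc) hPx
    · exact h
  refine (measure_mono ?_).trans (hε' (‖c‖⁻¹ • c) (by simp [norm_smul, hc.ne']))
  rintro y ⟨hy, hy'⟩
  refine ⟨hy, ?_⟩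
  have h1 : q (‖c‖⁻¹ • c) y = ‖c‖⁻¹ * polyFun P y := by
    rw [← hcP]; simp [q, Finset.mul_sum, mul_assoc]
  rw [h1, abs_mul, abs_of_pos (inv_pos.2 hc), inv_mul_le_iff₀ hc]
  calc |polyFun P y| ≤ ε / R * |polyFun P x| := hy'
    _ ≤ ε / R * (‖c‖ * R) := by gcongr
    _ = ‖c‖ * ε := by field_simp

open scoped Pointwise in
/-- A polynomial of bounded degree is, on a substantial part of every set that fills a fixed fraction
of a ball, comparable to its value at any point of a larger ball. -/
theorem exists_volume_superlevel_ge (n : ℕ) (M : ℝ) {τ : ℝ} (hτ : 0 < τ) :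
    ∃ ε : ℝ, 0 < ε ∧ ∀ P : MvPolynomial (Fin d) ℝ, P.totalDegree ≤ n →
      ∀ (x₀ x : Pt d) (h : ℝ), 0 < h → dist x x₀ ≤ M * h → polyFun P x ≠ 0 →
      ∀ A ⊆ Metric.closedBall x₀ h, ENNReal.ofReal (τ * h ^ d) ≤ volume A →
        ENNReal.ofReal (τ / 2 * h ^ d) ≤ volume {y ∈ A | ε * |polyFun P x| < |polyFun P y|} := by
  obtain ⟨ε, hε, H⟩ := exists_volume_sublevel_unitBall_le (d := d) n M
    (τ := ENNReal.ofReal (τ / 2)) (by simpa using hτ)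
  refine ⟨ε, hε, fun P hP x₀ x h hh hx hPx A hA hvol => ?_⟩
  have hback : ∀ y : Pt d, x₀ + h • (h⁻¹ • (y - x₀)) = y := fun y => by
    rw [smul_inv_smul₀ hh.ne']; abel
  have h1 := H (polyRescale P x₀ h) ((totalDegree_polyRescale_le P x₀ h).trans hP)
    (h⁻¹ • (x - x₀)) (by
      rw [mem_closedBall_zero_iff, norm_smul, norm_inv, Real.norm_of_nonneg hh.le,
        inv_mul_le_iff₀ hh, ← dist_eq_norm, mul_comm]
      exact hx) (by rwa [polyFun_polyRescale, hback])
  rw [polyFun_polyRescale, hback] at h1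
  set Z := {z ∈ Metric.closedBall (0 : Pt d) 1 | |polyFun (polyRescale P x₀ h) z| ≤
    ε * |polyFun P x|} with hZ
  have h2 : volume {y ∈ A | |polyFun P y| ≤ ε * |polyFun P x|} ≤
      ENNReal.ofReal (τ / 2 * h ^ d) := by
    have hsub : {y ∈ A | |polyFun P y| ≤ ε * |polyFun P x|} ⊆ (fun z => x₀ + z) '' (h • Z) := by
      rintro y ⟨hy, hy'⟩
      refine ⟨y - x₀, ⟨h⁻¹ • (y - x₀), ⟨?_, ?_⟩, smul_inv_smul₀ hh.ne' _⟩, by simp⟩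
      · rw [mem_closedBall_zero_iff, norm_smul, norm_inv, Real.norm_of_nonneg hh.le,
          inv_mul_le_iff₀ hh, ← dist_eq_norm, mul_one]
        exact hA hy
      · rwa [polyFun_polyRescale, hback]
    refine (measure_mono hsub).trans ?_
    rw [image_add_left, measure_preimage_add, Measure.addHaar_smul]
    simp only [finrank_euclideanSpace, Fintype.card_fin, abs_of_nonneg (pow_nonneg hh.le d)]
    rw [mul_comm (τ / 2), ENNReal.ofReal_mul (by positivity)]
    gcongr
  -- The sublevel part takes at most half of the guaranteed measure of `A`; the superlevel part
  -- keeps the other half.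
  have h3 : volume A ≤ volume {y ∈ A | |polyFun P y| ≤ ε * |polyFun P x|} +
      volume {y ∈ A | ε * |polyFun P x| < |polyFun P y|} := by
    refine (measure_mono ?_).trans (measure_union_le _ _)
    intro y hy
    rcases le_or_gt |polyFun P y| (ε * |polyFun P x|) with h | h
    · exact Or.inl ⟨hy, h⟩
    · exact Or.inr ⟨hy, h⟩
  have h4 := (hvol.trans h3).trans (add_le_add_left h2 _)
  have h5 : ENNReal.ofReal (τ * h ^ d) =
      ENNReal.ofReal (τ / 2 * h ^ d) + ENNReal.ofReal (τ / 2 * h ^ d) := by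
    rw [← ENNReal.ofReal_add (by positivity) (by positivity)]; congr 1; ring
  rw [h5] at h4
  exact (ENNReal.add_le_add_iff_left ENNReal.ofReal_ne_top).1 h4

end TrimmedIGA

namespace TrimmedIGA

/-! ### Splines are piecewise polynomials -/

/-- Inside one knot span each step of the recursion multiplies by affine factors, raising the degree
by at most one. A vanishing knot difference needs no separate case, because its inverse is zero on
both sides. -/
theorem coxDeBoor_eq_polynomial {p : ℕ} (ξ : KnotVector p) {m : ℕ} (hm : m + 1 ≤ ξ.n + p) :
    ∀ q i : ℕ, i + q + 1 ≤ ξ.n + p → ∃ f : Polynomial ℝ, f.natDegree ≤ q ∧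
      ∀ x, ξ.knot m < x → x < ξ.knot (m + 1) → coxDeBoor ξ.knot q i x = f.eval x
  | 0, i, hi => by
    refine ⟨Polynomial.C (if i = m then 1 else 0), (Polynomial.natDegree_C _).le, fun x hx hx' => ?_⟩
    -- This excludes the clause that closes the last knot span at `1`.
    have h1 : x < 1 := by
      rw [← ξ.right (ξ.n + p) (by omega) le_rfl]
      exact hx'.trans_le (ξ.mono _ _ hm le_rfl)
    rw [Polynomial.eval_C, coxDeBoor]
    rcases lt_trichotomy i m with h | rfl | h
    · have := ξ.mono (i + 1) m h (by omega)
      rw [if_neg h.ne, if_neg]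
      rintro ⟨-, h2 | h2⟩
      · linarith
      · exact h1.ne h2.1
    · rw [if_pos rfl, if_pos ⟨hx.le, Or.inl hx'⟩]
    · have := ξ.mono (m + 1) i h (by omega)
      rw [if_neg h.ne', if_neg]
      rintro ⟨h2, -⟩
      linarith
  | q + 1, i, hi => by
    obtain ⟨f, hf, hf'⟩ := coxDeBoor_eq_polynomial ξ hm q i (by omega)
    obtain ⟨g, hg, hg'⟩ := coxDeBoor_eq_polynomial ξ hm q (i + 1) (by omega)
    refine ⟨Polynomial.C (ξ.knot (i + q + 1) - ξ.knot i)⁻¹ *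
        (Polynomial.X - Polynomial.C (ξ.knot i)) * f +
      Polynomial.C (ξ.knot (i + q + 2) - ξ.knot (i + 1))⁻¹ *
        (Polynomial.C (ξ.knot (i + q + 2)) - Polynomial.X) * g, ?_, fun x hx hx' => ?_⟩
    · refine Polynomial.natDegree_add_le_of_degree_le ?_ ?_
      · rw [mul_assoc]
        refine (Polynomial.natDegree_C_mul_le _ _).trans (Polynomial.natDegree_mul_le.trans ?_)
        rw [Polynomial.natDegree_X_sub_C]
        omega
      · rw [mul_assoc]
        refine (Polynomial.natDegree_C_mul_le _ _).trans (Polynomial.natDegree_mul_le.trans ?_)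
        rw [Polynomial.natDegree_sub, Polynomial.natDegree_X_sub_C]
        omega
    · rw [coxDeBoor, hf' x hx hx', hg' x hx hx']
      simp only [Polynomial.eval_add, Polynomial.eval_mul, Polynomial.eval_sub, Polynomial.eval_C,
        Polynomial.eval_X]
      ring

variable {d p : ℕ}

theorem exists_polyFun_eq_prod (f : Fin d → Polynomial ℝ) (hf : ∀ l, (f l).natDegree ≤ p) :
    ∃ P ∈ MvPolynomial.restrictDegree (Fin d) ℝ p, ∀ x : Pt d,
      polyFun P x = ∏ l, (f l).eval (x l) := by
  refine ⟨∑ α ∈ Fintype.piFinset fun _ : Fin d => Finset.range (p + 1),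
    MvPolynomial.monomial (Finsupp.equivFunOnFinite.symm α) (∏ l, (f l).coeff (α l)), ?_, ?_⟩
  · refine Submodule.sum_mem _ fun α hα => ?_
    rw [MvPolynomial.mem_restrictDegree]
    intro s hs i
    have := MvPolynomial.support_monomial_subset hs
    rw [Finset.mem_singleton] at this
    subst this
    exact Nat.lt_succ_iff.1 (Finset.mem_range.1 (Fintype.mem_piFinset.1 hα i))
  · intro x
    have h : ∀ l, (f l).eval (x l) = ∑ k ∈ Finset.range (p + 1), (f l).coeff k * x l ^ k := fun l =>
      Polynomial.eval_eq_sum_range' (Nat.lt_succ_iff.2 (hf l)) _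
    simp_rw [h, Finset.prod_univ_sum, polyFun, map_sum, Finset.prod_mul_distrib]
    refine Finset.sum_congr rfl fun α _ => ?_
    rw [MvPolynomial.eval_monomial, Finsupp.prod_fintype _ _ (fun _ => pow_zero _)]
    rfl

theorem tensorBSpline_eq_polyFun (Ξ : Fin d → KnotVector p) {i j : Fin d → ℕ} (hi : IsSpan Ξ i)
    (hj : ∀ l, j l < (Ξ l).n) :
    ∃ P ∈ MvPolynomial.restrictDegree (Fin d) ℝ p, ∀ x ∈ cell Ξ i,
      polyFun P x = tensorBSpline Ξ j x := by
  choose f hf hf' using fun l => coxDeBoor_eq_polynomial (Ξ l) (hi l).1 p (j l)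
    (by have := hj l; omega)
  obtain ⟨P, hP, hP'⟩ := exists_polyFun_eq_prod f hf
  refine ⟨P, hP, fun x hx => ?_⟩
  rw [hP', tensorBSpline]
  exact Finset.prod_congr rfl fun l _ => (hf' l _ (hx l).1 (hx l).2).symm

theorem paramInv_apply {F : Pt d → Pt d} (hF : InjOn F (cube d)) {x : Pt d} (hx : x ∈ cube d) :
    paramInv F (F x) = x :=
  hF.leftInvOn_invFunOn hx

/-- The pull-back of a function of the discrete space is a polynomial on the part of a parametric
element inside the trimmed domain. -/
theorem exists_polyFun_eq_trimmed {F : Pt d → Pt d} (hF : InjOn F (cube d))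
    (Ξ : Fin d → KnotVector p) {Ω : Set (Pt d)} {i : Fin d → ℕ} (hi : IsSpan Ξ i)
    {v : Pt d → ℝ} (hv : v ∈ trimmedSpace F Ξ Ω) :
    ∃ P ∈ MvPolynomial.restrictDegree (Fin d) ℝ p, ∀ x ∈ pullback F Ω ∩ cell Ξ i,
      polyFun P x = v (F x) := by
  induction hv using Submodule.span_induction with
  | mem v hv =>
    obtain ⟨j, hj, rfl⟩ := hv
    obtain ⟨P, hP, hP'⟩ := tensorBSpline_eq_polyFun Ξ hi hj
    refine ⟨P, hP, fun x hx => ?_⟩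
    rw [indicator_of_mem hx.1.2, paramInv_apply hF hx.1.1, hP' x hx.2]
  | zero => exact ⟨0, Submodule.zero_mem _, fun x _ => by simp [polyFun]⟩
  | add v w _ _ hv hw =>
    obtain ⟨P, hP, hP'⟩ := hv
    obtain ⟨R, hR, hR'⟩ := hw
    refine ⟨P + R, Submodule.add_mem _ hP hR, fun x hx => ?_⟩
    rw [Pi.add_apply, ← hP' x hx, ← hR' x hx]
    simp [polyFun]
  | smul a v _ hv =>
    obtain ⟨P, hP, hP'⟩ := hv
    refine ⟨a • P, Submodule.smul_mem _ a hP, fun x hx => ?_⟩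
    rw [Pi.smul_apply, ← hP' x hx]
    simp [polyFun, MvPolynomial.smul_eval]

/-- These two properties of the chosen polynomial are all that the estimates use; its uniqueness
does not enter. -/
theorem polyExtension_spec {A : Set (Pt d)} {w : Pt d → ℝ}
    (h : ∃ P ∈ MvPolynomial.restrictDegree (Fin d) ℝ p, ∀ x ∈ A, polyFun P x = w x) :
    polyExtension p A w ∈ MvPolynomial.restrictDegree (Fin d) ℝ p ∧
      ∀ x ∈ A, polyFun (polyExtension p A w) x = w x := by
  rw [polyExtension, dif_pos h]
  exact h.choose_spec

/-! ### The parametric mesh -/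

section Mesh

variable {Ξ : Fin d → KnotVector p} {i : Fin d → ℕ}

theorem IsSpan.knot_mem (hi : IsSpan Ξ i) (l : Fin d) :
    0 ≤ (Ξ l).knot (i l) ∧ (Ξ l).knot (i l + 1) ≤ 1 := by
  constructor
  · rw [← (Ξ l).left 0 (Nat.zero_le _)]
    exact (Ξ l).mono _ _ (Nat.zero_le _) ((Nat.le_succ _).trans (hi l).1)
  · rw [← (Ξ l).right ((Ξ l).n + p) (by omega) le_rfl]
    exact (Ξ l).mono _ _ (hi l).1 le_rfl

theorem cell_subset_cube (hi : IsSpan Ξ i) : cell Ξ i ⊆ cube d := fun _ hx l =>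
  ⟨(hi.knot_mem l).1.trans_lt (hx l).1, (hx l).2.trans_le (hi.knot_mem l).2⟩

theorem isOpen_cell (Ξ : Fin d → KnotVector p) (i : Fin d → ℕ) : IsOpen (cell Ξ i) := by
  have : cell Ξ i = ⋂ l, {x : Pt d | (Ξ l).knot (i l) < x l ∧ x l < (Ξ l).knot (i l + 1)} := by
    ext; simp [cell]
  rw [this]
  exact isOpen_iInter_of_finite fun l =>
    isOpen_Ioo.preimage (EuclideanSpace.proj l : Pt d →L[ℝ] ℝ).continuous

theorem isOpen_cube (d : ℕ) : IsOpen (cube d) := by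
  have : cube d = ⋂ l, {x : Pt d | 0 < x l ∧ x l < 1} := by ext; simp [cube]
  rw [this]
  exact isOpen_iInter_of_finite fun l =>
    isOpen_Ioo.preimage (EuclideanSpace.proj l : Pt d →L[ℝ] ℝ).continuous

theorem isBounded_cell (Ξ : Fin d → KnotVector p) (i : Fin d → ℕ) :
    Bornology.IsBounded (cell Ξ i) := by
  have h : Bornology.IsBounded (Set.pi univ fun l => Ioo ((Ξ l).knot (i l)) ((Ξ l).knot (i l + 1))) :=
    Bornology.IsBounded.pi fun l => Metric.isBounded_Ioo _ _
  refine ((PiLp.antilipschitzWith_ofLp 2 (fun _ : Fin d => ℝ)).isBounded_preimage h).subset ?_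
  exact fun x hx l _ => hx l

theorem cell_nonempty (hi : IsSpan Ξ i) : (cell Ξ i).Nonempty := by
  choose x hx using fun l => exists_between (hi l).2
  exact ⟨WithLp.toLp 2 x, hx⟩

/-- Points of the cell that differ only in coordinate `l` realise every length below the edge; the
edge itself is reached in the limit, since the cell is open. -/
theorem edge_le_diam_cell (hi : IsSpan Ξ i) (l : Fin d) :
    (Ξ l).knot (i l + 1) - (Ξ l).knot (i l) ≤ Metric.diam (cell Ξ i) := by
  obtain ⟨x, hx⟩ := cell_nonempty hi
  set a := (Ξ l).knot (i l)
  set b := (Ξ l).knot (i l + 1)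
  have key : ∀ s t : ℝ, a < s → s < b → a < t → t < b → t - s ≤ Metric.diam (cell Ξ i) := by
    intro s t hs hs' ht ht'
    have mem : ∀ r, a < r → r < b → WithLp.toLp 2 (Function.update x.ofLp l r) ∈ cell Ξ i := by
      intro r hr hr' k
      rcases eq_or_ne k l with rfl | hk
      · simpa using ⟨hr, hr'⟩
      · simpa [hk] using hx k
    have h1 := Metric.dist_le_diam_of_mem (isBounded_cell Ξ i) (mem t ht ht') (mem s hs hs')
    refine le_trans ?_ h1
    rw [dist_eq_norm]
    refine le_trans ?_ (PiLp.norm_apply_le _ l)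
    simpa using le_abs_self (t - s)
  have hab : a < b := (hi l).2
  refine le_of_forall_pos_lt_add fun ε hε => ?_
  obtain ⟨s, hs, hs'⟩ := exists_between (show a < min b (a + ε / 2) from lt_min hab (by linarith))
  obtain ⟨t, ht, ht'⟩ := exists_between (show max a (b - ε / 2) < b from max_lt hab (by linarith))
  have := key s t hs (hs'.trans_le (min_le_left _ _)) ((le_max_left _ _).trans_lt ht) ht'
  have h1 := hs'.trans_le (min_le_right _ _)
  have h2 := (le_max_right _ _).trans_lt ht
  linarith

theorem volume_cell (hi : IsSpan Ξ i) :
    volume (cell Ξ i) = ENNReal.ofReal (∏ l, ((Ξ l).knot (i l + 1) - (Ξ l).knot (i l))) := by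
  have h := (PiLp.volume_preserving_ofLp (Fin d)).measure_preimage
    (s := Set.pi univ fun l => Ioo ((Ξ l).knot (i l)) ((Ξ l).knot (i l + 1)))
    (MeasurableSet.univ_pi fun _ => measurableSet_Ioo).nullMeasurableSet
  have h' : (@WithLp.ofLp 2 (Fin d → ℝ)) ⁻¹'
      (Set.pi univ fun l => Ioo ((Ξ l).knot (i l)) ((Ξ l).knot (i l + 1))) = cell Ξ i := by
    ext x; simp [cell]
  rw [h', Real.volume_pi_Ioo] at h
  rw [h, ENNReal.ofReal_prod_of_nonneg fun l _ => sub_nonneg.2 (hi l).2.le]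

variable {σ : ℝ}

theorem ShapeRegular.pow_le_volume (hσ : 0 < σ) (h : ShapeRegular σ Ξ) (hi : IsSpan Ξ i) :
    ENNReal.ofReal ((Metric.diam (cell Ξ i) / σ) ^ d) ≤ volume (cell Ξ i) := by
  rw [volume_cell hi]
  refine ENNReal.ofReal_le_ofReal ?_
  calc (Metric.diam (cell Ξ i) / σ) ^ d = ∏ _l : Fin d, Metric.diam (cell Ξ i) / σ := by
        rw [Finset.prod_const, Finset.card_univ, Fintype.card_fin]
    _ ≤ _ := Finset.prod_le_prod (fun l _ => div_nonneg Metric.diam_nonneg hσ.le) fun l _ =>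
      (div_le_iff₀' hσ).2 (h i hi l)

/-- In at least two space dimensions, a shape regular tensor-product mesh is quasi-uniform. -/
theorem ShapeRegular.diam_le (hσ : 0 ≤ σ) (h : ShapeRegular σ Ξ) (hd : 2 ≤ d) {j : Fin d → ℕ}
    (hi : IsSpan Ξ i) (hj : IsSpan Ξ j) :
    Metric.diam (cell Ξ i) ≤ σ ^ 2 * Metric.diam (cell Ξ j) := by
  let a : Fin d := ⟨0, by omega⟩
  let b : Fin d := ⟨1, by omega⟩
  have hba : b ≠ a := by simp [a, b]
  -- The mixed element `m` has the `a`-edge of `i` and the `b`-edge of `j`. Its own shape regularity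
  -- compares the two, which is why a second direction is needed.
  let m := Function.update j a (i a)
  have ha : m a = i a := by simp [m]
  have hb : m b = j b := by simp [m, hba]
  have hm : IsSpan Ξ m := by
    intro l
    rcases eq_or_ne l a with rfl | hl
    · rw [ha]; exact hi a
    · rw [show m l = j l by simp [m, hl]]; exact hj l
  have h1 := h i hi a
  have h2 := edge_le_diam_cell hm a
  have h3 := h m hm b
  have h4 := edge_le_diam_cell hj b
  rw [ha] at h2
  rw [hb] at h3
  calc Metric.diam (cell Ξ i) ≤ σ * _ := h1
    _ ≤ σ * (σ * Metric.diam (cell Ξ j)) := by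
      refine mul_le_mul_of_nonneg_left (h2.trans (h3.trans ?_)) hσ
      exact mul_le_mul_of_nonneg_left h4 hσ
    _ = _ := by ring

end Mesh

end TrimmedIGA

namespace TrimmedIGA

variable {d : ℕ}

/-! ### Measurability of the outward normal -/

/-- If the normals differed, moving from `x` a little along `ν - μ` would lead to a point strictly
on the outer side for `ν` and strictly on the inner side for `μ`, which can lie neither in `Ω` nor
outside it. -/
theorem IsOutwardNormal.eq {Ω : Set (Pt d)} {x ν μ : Pt d} (hν : IsOutwardNormal Ω x ν)
    (hμ : IsOutwardNormal Ω x μ) : ν = μ := by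
  by_contra hne
  set c : ℝ := inner ℝ ν μ
  have hc : c < 1 := inner_lt_one_iff_real_of_norm_eq_one hν.1 hμ.1 |>.2 hne
  set w := ν - μ
  have hw : 0 < ‖w‖ := norm_pos_iff.2 (sub_ne_zero.2 hne)
  have h1 : inner ℝ w ν = 1 - c := by
    simp [w, inner_sub_left, hν.1, c, real_inner_comm]
  have h2 : inner ℝ w μ = c - 1 := by
    simp [w, inner_sub_left, hμ.1, c]
  set ε := (1 - c) / (2 * ‖w‖)
  have hε : 0 < ε := div_pos (by linarith) (by positivity)
  have hεw : ε * ‖w‖ = (1 - c) / 2 := by simp only [ε]; field_simp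
  obtain ⟨δ, hδ, H⟩ := hν.2 ε hε
  obtain ⟨δ', hδ', H'⟩ := hμ.2 ε hε
  set t := min δ δ' / (2 * ‖w‖)
  have ht : 0 < t := div_pos (lt_min hδ hδ') (by positivity)
  have htw : ‖t • w‖ = min δ δ' / 2 := by
    rw [norm_smul, Real.norm_of_nonneg ht.le]; simp only [t]; field_simp
  have hmin := lt_min hδ hδ'
  have hy : x + t • w ∈ Metric.ball x δ := by
    rw [mem_ball_iff_norm, add_sub_cancel_left, htw]
    have := min_le_left δ δ'
    linarith
  have hy' : x + t • w ∈ Metric.ball x δ' := by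
    rw [mem_ball_iff_norm, add_sub_cancel_left, htw]
    have := min_le_right δ δ'
    linarith
  have hnorm : ε * ‖t • w‖ = t * ((1 - c) / 2) := by
    rw [norm_smul, Real.norm_of_nonneg ht.le, ← hεw]; ring
  have hpos : 0 < t * ((1 - c) / 2) := mul_pos ht (by linarith)
  by_cases hΩ : x + t • w ∈ Ω
  · have := (H _ hy).1 hΩ
    rw [add_sub_cancel_left, hnorm, real_inner_smul_left, h1] at this
    linarith
  · have := (H' _ hy').2 hΩ
    rw [add_sub_cancel_left, hnorm, real_inner_smul_left, h2] at this
    linarith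

theorem outwardNormal_eq {Ω : Set (Pt d)} {x ν : Pt d} (hν : IsOutwardNormal Ω x ν) :
    outwardNormal Ω x = ν := by
  have h : ∃ ν, IsOutwardNormal Ω x ν := ⟨ν, hν⟩
  rw [outwardNormal, dif_pos h]
  exact h.choose_spec.eq hν

theorem norm_outwardNormal_le (Ω : Set (Pt d)) (x : Pt d) : ‖outwardNormal Ω x‖ ≤ 1 := by
  rw [outwardNormal]
  split_ifs with h
  · exact h.choose_spec.1.le
  · simp

/-- Both `ε` and `δ` may be restricted to reciprocals of integers. For fixed values the condition is
closed in the pair of point and vector, being an intersection of closed conditions over `y`, so no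
regularity of `Ω` is needed. -/
theorem measurableSet_isOutwardNormal (Ω : Set (Pt d)) :
    MeasurableSet {z : Pt d × Pt d | IsOutwardNormal Ω z.1 z.2} := by
  let E : ℕ → ℕ → Set (Pt d × Pt d) := fun n m => {z | ∀ y, dist y z.1 < 1 / ((m : ℝ) + 1) →
    (y ∈ Ω → inner ℝ (y - z.1) z.2 ≤ 1 / ((n : ℝ) + 1) * ‖y - z.1‖) ∧
      (y ∉ Ω → -(1 / ((n : ℝ) + 1) * ‖y - z.1‖) ≤ inner ℝ (y - z.1) z.2)}
  have himp : ∀ (a : Prop) {f g : Pt d × Pt d → ℝ}, Continuous f → Continuous g →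
      IsClosed {z | a → f z ≤ g z} := by
    intro a f g hf hg
    by_cases ha : a
    · simpa [ha] using isClosed_le hf hg
    · simp [ha]
  have hE : ∀ n m, IsClosed (E n m) := by
    intro n m
    simp only [E, ofPred_forall]
    refine isClosed_iInter fun y => ?_
    -- The strict inequality in `E` makes the negated premise closed.
    simp only [imp_iff_not_or (a := dist y _ < _), not_lt]
    exact (isClosed_le (g := fun z : Pt d × Pt d => dist y z.1) continuous_const
      (by fun_prop)).union
        ((himp (y ∈ Ω) (by fun_prop) (by fun_prop)).inter
          (himp (y ∉ Ω) (f := fun z => -(1 / ((n : ℝ) + 1) * ‖y - z.1‖)) (by fun_prop)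
            (by fun_prop)))
  have heq : {z : Pt d × Pt d | IsOutwardNormal Ω z.1 z.2} =
      {z | ‖z.2‖ = 1} ∩ ⋂ n, ⋃ m, E n m := by
    ext z
    simp only [IsOutwardNormal, mem_inter_iff, mem_iInter, mem_iUnion, mem_ofPred_eq]
    refine and_congr_right fun _ => ⟨fun h n => ?_, fun h ε hε => ?_⟩
    · obtain ⟨δ, hδ, H⟩ := h (1 / ((n : ℝ) + 1)) (by positivity)
      obtain ⟨m, hm⟩ := exists_nat_one_div_lt hδ
      exact ⟨m, fun y hy => H y (hy.trans hm)⟩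
    · obtain ⟨n, hn⟩ := exists_nat_one_div_lt hε
      obtain ⟨m, hm⟩ := h n
      refine ⟨1 / ((m : ℝ) + 1), by positivity, fun y hy => ?_⟩
      have hle : 1 / ((n : ℝ) + 1) * ‖y - z.1‖ ≤ ε * ‖y - z.1‖ := by gcongr
      exact ⟨fun hyΩ => ((hm y hy).1 hyΩ).trans hle,
        fun hyΩ => (neg_le_neg hle).trans ((hm y hy).2 hyΩ)⟩
  rw [heq]
  refine (isClosed_eq (by fun_prop) continuous_const).measurableSet.inter ?_
  exact MeasurableSet.iInter fun n => MeasurableSet.iUnion fun m => (hE n m).measurableSet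

/-- The graph of the normal is Borel, and uniqueness makes its projection to the point injective, so
the Lusin-Souslin theorem makes projections of its Borel parts Borel. Off the projection of the
whole graph the field has its default value zero. -/
theorem measurable_outwardNormal (Ω : Set (Pt d)) : Measurable (outwardNormal Ω) := by
  set G := {z : Pt d × Pt d | IsOutwardNormal Ω z.1 z.2}
  have himage : ∀ T : Set (Pt d), MeasurableSet T →
      MeasurableSet (Prod.fst '' (G ∩ Prod.snd ⁻¹' T)) := fun T hT =>
    ((measurableSet_isOutwardNormal Ω).inter (measurable_snd hT)).image_of_continuousOn_injOn
      continuous_fst.continuousOn (by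
        rintro ⟨x, ν⟩ ⟨hν, -⟩ ⟨x', ν'⟩ ⟨hν', -⟩ (rfl : x = x')
        exact Prod.ext rfl (IsOutwardNormal.eq hν hν'))
  intro T hT
  have heq : outwardNormal Ω ⁻¹' T = Prod.fst '' (G ∩ Prod.snd ⁻¹' T) ∪
      ((Prod.fst '' (G ∩ Prod.snd ⁻¹' univ))ᶜ ∩ {_x | (0 : Pt d) ∈ T}) := by
    ext x
    by_cases h : ∃ ν, IsOutwardNormal Ω x ν
    · obtain ⟨ν, hν⟩ := h
      have h1 : x ∈ Prod.fst '' (G ∩ Prod.snd ⁻¹' univ) := ⟨(x, ν), ⟨hν, trivial⟩, rfl⟩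
      rw [mem_preimage, outwardNormal_eq hν]
      refine ⟨fun hT => Or.inl ⟨(x, ν), ⟨hν, hT⟩, rfl⟩, ?_⟩
      rintro (⟨⟨x', ν'⟩, ⟨hν', hT'⟩, rfl⟩ | ⟨h2, -⟩)
      · rw [hν.eq hν']; exact hT'
      · exact absurd h1 h2
    · rw [mem_preimage, outwardNormal, dif_neg h]
      refine ⟨fun hT => Or.inr ⟨?_, hT⟩, ?_⟩
      · rintro ⟨⟨x', ν'⟩, ⟨hν', -⟩, rfl⟩
        exact h ⟨ν', hν'⟩
      · rintro (⟨⟨x', ν'⟩, ⟨hν', -⟩, rfl⟩ | ⟨-, h2⟩)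
        · exact absurd ⟨ν', hν'⟩ h
        · exact h2
  rw [heq]
  exact (himage T hT).union ((himage univ MeasurableSet.univ).compl.inter (MeasurableSet.const _))

/-! ### Gradients -/

theorem norm_gradient (f : Pt d → ℝ) (x : Pt d) : ‖gradient f x‖ = ‖fderiv ℝ f x‖ := by
  rw [gradient, LinearIsometryEquiv.norm_map]

/-- A `C^1` function on the closure has, near `x`, a derivative relative to the closure that is
continuous at `x`. At points of the open set `U` this is the ordinary derivative of `g`. -/
theorem exists_tendsto_gradient {U : Set (Pt d)} (hU : IsOpen U) {g h : Pt d → ℝ}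
    (hh : ContDiffOn ℝ 1 h (closure U)) (hgh : EqOn h g U) {x : Pt d} (hx : x ∈ closure U) :
    ∃ y, Filter.Tendsto (gradient g) (𝓝[U] x) (𝓝 y) := by
  have h1 : ContDiffWithinAt ℝ ((0 : WithTop ℕ∞) + 1) h (closure U) x := by
    rw [zero_add]; exact hh x hx
  obtain ⟨u, hu, -, f', hf', hf'c⟩ :=
    (contDiffWithinAt_succ_iff_hasFDerivWithinAt (by simp)).1 h1
  rw [insert_eq_of_mem hx] at hu
  have hu' : u ∈ 𝓝[U] x := nhdsWithin_mono x subset_closure hu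
  have hlim : Filter.Tendsto f' (𝓝[U] x) (𝓝 (f' x)) :=
    hf'c.continuousWithinAt.tendsto.mono_left (nhdsWithin_le_of_mem hu')
  refine ⟨_, (((InnerProductSpace.toDual ℝ (Pt d)).symm.continuous.tendsto _).comp hlim).congr' ?_⟩
  obtain ⟨o, ho, hxo, hou⟩ := mem_nhdsWithin.1 hu
  filter_upwards [self_mem_nhdsWithin, mem_nhdsWithin_of_mem_nhds (ho.mem_nhds hxo)] with y hy hyo
  have hyu : u ∈ 𝓝 y := Filter.mem_of_superset ((ho.inter hU).mem_nhds ⟨hyo, hy⟩)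
    fun z hz => hou ⟨hz.1, subset_closure hz.2⟩
  have h2 : HasFDerivAt h (f' y) y := (hf' y (mem_of_mem_nhds hyu)).hasFDerivAt hyu
  have h3 : HasFDerivAt g (f' y) y :=
    h2.congr_of_eventuallyEq (Filter.eventuallyEq_of_mem (hU.mem_nhds hy) fun z hz => (hgh hz).symm)
  rw [Function.comp_apply, gradient, h3.fderiv]

/-! ### The parametrization -/

section Parametrization

variable {F : Pt d → Pt d} {c₁ c₂ : ℝ}

theorem paramInv_mem {y : Pt d} (hy : y ∈ F '' cube d) : paramInv F y ∈ cube d :=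
  Function.invFunOn_mem hy

theorem apply_paramInv {y : Pt d} (hy : y ∈ F '' cube d) : F (paramInv F y) = y :=
  Function.invFunOn_eq hy

theorem injOn_of_le_dist (hc₁ : 0 < c₁)
    (hF : ∀ x ∈ cube d, ∀ y ∈ cube d, c₁ * dist x y ≤ dist (F x) (F y)) : InjOn F (cube d) := by
  intro x hx y hy hxy
  have := hF x hx y hy
  rw [hxy, dist_self] at this
  exact dist_le_zero.1 (nonpos_of_mul_nonpos_right this hc₁)

theorem lipschitzOnWith_paramInv (hc₁ : 0 < c₁)
    (hF : ∀ x ∈ cube d, ∀ y ∈ cube d, c₁ * dist x y ≤ dist (F x) (F y)) :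
    LipschitzOnWith (Real.toNNReal c₁⁻¹) (paramInv F) (F '' cube d) := by
  refine LipschitzOnWith.of_dist_le_mul fun x hx y hy => ?_
  rw [Real.coe_toNNReal _ (inv_nonneg.2 hc₁.le), le_inv_mul_iff₀ hc₁]
  have := hF _ (paramInv_mem hx) _ (paramInv_mem hy)
  rwa [apply_paramInv hx, apply_paramInv hy] at this

theorem paramInv_image (hinj : InjOn F (cube d)) {S : Set (Pt d)} (hS : S ⊆ cube d) :
    paramInv F '' (F '' S) = S := by
  rw [image_image]
  conv_rhs => rw [← image_id S]
  exact image_congr fun x hx => paramInv_apply hinj (hS hx)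

theorem isOpen_image_param (hc₁ : 0 < c₁)
    (hF : ∀ x ∈ cube d, ∀ y ∈ cube d, c₁ * dist x y ≤ dist (F x) (F y))
    (hopen : IsOpen (F '' cube d)) {U : Set (Pt d)} (hU : IsOpen U) (hUc : U ⊆ cube d) :
    IsOpen (F '' U) := by
  have heq : F '' U = F '' cube d ∩ paramInv F ⁻¹' U := by
    ext y
    constructor
    · rintro ⟨x, hx, rfl⟩
      refine ⟨⟨x, hUc hx, rfl⟩, ?_⟩
      rw [mem_preimage, paramInv_apply (injOn_of_le_dist hc₁ hF) (hUc hx)]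
      exact hx
    · rintro ⟨hy, hy'⟩
      exact ⟨_, hy', apply_paramInv hy⟩
  rw [heq]
  exact (lipschitzOnWith_paramInv hc₁ hF).continuousOn.isOpen_inter_preimage hopen hU

/-- Volume is a multiple of the `d`-dimensional Hausdorff measure, which a Lipschitz map, here
`paramInv F`, enlarges by at most the `d`-th power of its constant, for arbitrary sets. -/
theorem volume_le_volume_image (hc₁ : 0 < c₁)
    (hF : ∀ x ∈ cube d, ∀ y ∈ cube d, c₁ * dist x y ≤ dist (F x) (F y)) {S : Set (Pt d)}
    (hS : S ⊆ cube d) : volume S ≤ ENNReal.ofReal (c₁⁻¹ ^ d) * volume (F '' S) := by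
  have h := ((lipschitzOnWith_paramInv hc₁ hF).mono (image_mono hS)).hausdorffMeasure_image_le
    (d := d) (Nat.cast_nonneg d)
  rw [paramInv_image (injOn_of_le_dist hc₁ hF) hS] at h
  rw [← EuclideanSpace.euclideanHausdorffMeasure_eq_volume, Measure.euclideanHausdorffMeasure_def,
    Measure.smul_apply, Measure.smul_apply, ENNReal.smul_def, ENNReal.smul_def, smul_eq_mul,
    smul_eq_mul, mul_left_comm]
  gcongr
  refine h.trans_eq ?_
  rw [ENNReal.rpow_natCast, ENNReal.ofReal_pow (inv_nonneg.2 hc₁.le), ENNReal.ofReal]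

theorem lipschitzOnWith_param (hc₂ : 0 < c₂)
    (hF : ∀ x ∈ cube d, ∀ y ∈ cube d, dist (F x) (F y) ≤ c₂ * dist x y) :
    LipschitzOnWith (Real.toNNReal c₂) F (cube d) := by
  refine LipschitzOnWith.of_dist_le_mul fun x hx y hy => ?_
  rw [Real.coe_toNNReal _ hc₂.le]
  exact hF x hx y hy

end Parametrization

/-! ### Lower and upper bounds for `L²` norms -/

theorem ofReal_mul_sqrt_le_eLpNorm {g : Pt d → Pt d} {S T : Set (Pt d)} (hS : MeasurableSet S)
    (hST : S ⊆ T) {c m : ℝ} (hc : 0 ≤ c) (hg : ∀ x ∈ S, c ≤ ‖g x‖)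
    (hm : ENNReal.ofReal m ≤ volume S) :
    ENNReal.ofReal (c * √m) ≤ eLpNorm g 2 (volume.restrict T) := by
  refine le_trans ?_ (eLpNorm_mono_measure g (Measure.restrict_mono hST le_rfl))
  have h1 : eLpNorm (fun _ : Pt d => c) 2 (volume.restrict S) ≤ eLpNorm g 2 (volume.restrict S) := by
    refine eLpNorm_mono_ae ?_
    filter_upwards [ae_restrict_mem hS] with x hx
    rw [Real.norm_of_nonneg hc]
    exact hg x hx
  refine le_trans ?_ h1
  rw [eLpNorm_const' _ (by norm_num) (by norm_num), Measure.restrict_apply_univ,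
    Real.enorm_of_nonneg hc, ENNReal.ofReal_mul hc, Real.sqrt_eq_rpow]
  gcongr
  rcases le_total m 0 with h | h
  · rw [← Real.sqrt_eq_rpow, Real.sqrt_eq_zero_of_nonpos h]; simp
  · rw [← ENNReal.ofReal_rpow_of_nonneg h (by norm_num)]
    simpa using ENNReal.rpow_le_rpow hm (by norm_num : (0 : ℝ) ≤ 1 / 2)

theorem eLpNorm_le_ofReal_mul_sqrt {μ : Measure (Pt d)} {f : Pt d → ℝ} {c m : ℝ} (hc : 0 ≤ c)
    (hm : 0 ≤ m) (hf : ∀ᵐ x ∂μ, ‖f x‖ ≤ c) (hμ : μ univ ≤ ENNReal.ofReal m) :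
    eLpNorm f 2 μ ≤ ENNReal.ofReal (c * √m) := by
  refine (eLpNorm_le_of_ae_bound hf).trans ?_
  rw [ENNReal.ofReal_mul hc, mul_comm, Real.sqrt_eq_rpow,
    ← ENNReal.ofReal_rpow_of_nonneg hm (by norm_num)]
  gcongr
  simpa using ENNReal.rpow_le_rpow hμ (by norm_num : (0 : ℝ) ≤ 1 / 2)

end TrimmedIGA

/-! ### Transfer of gradient bounds between the parametric and the physical domain -/

namespace TrimmedIGA

variable {d p : ℕ}

theorem SmoothUpToBoundary.differentiableAt {g : Pt d → Pt d} {U : Set (Pt d)} (hU : IsOpen U)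
    (h : SmoothUpToBoundary g U) {x : Pt d} (hx : x ∈ U) : DifferentiableAt ℝ g x := by
  obtain ⟨G, hG, hGg⟩ := h
  have h1 : DifferentiableAt ℝ G x :=
    ((hG.mono subset_closure).contDiffAt (hU.mem_nhds hx)).differentiableAt (by simp)
  exact h1.congr_of_eventuallyEq
    (Filter.eventuallyEq_of_mem (hU.mem_nhds hx) fun z hz => (hGg hz).symm)

theorem contDiff_polyFun (P : MvPolynomial (Fin d) ℝ) : ContDiff ℝ ∞ (polyFun P) := by
  unfold polyFun
  simp_rw [MvPolynomial.eval_eq']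
  fun_prop

section Estimates

variable {F : Pt d → Pt d} {c₁ c₂ : ℝ}

/-- The gradient of the push-forward of a polynomial has a continuous extension to the closure of
the physical element, bounded by the gradient of the polynomial. -/
theorem continuousOn_extendFrom_gradient (hc₁ : 0 < c₁)
    (hF : ∀ x ∈ cube d, ∀ y ∈ cube d, c₁ * dist x y ≤ dist (F x) (F y))
    (hopen : IsOpen (F '' cube d)) {Q : Set (Pt d)} (hQ : IsOpen Q) (hQc : Q ⊆ cube d)
    (hsmooth : SmoothUpToBoundary (paramInv F) (F '' Q)) (P : MvPolynomial (Fin d) ℝ) {B : ℝ}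
    (hB : ∀ x ∈ Q, ‖gradient (polyFun P) x‖ ≤ B) :
    ContinuousOn (extendFrom (F '' Q) (gradient fun y => polyFun P (paramInv F y)))
        (closure (F '' Q)) ∧
      ∀ y ∈ closure (F '' Q),
        ‖extendFrom (F '' Q) (gradient fun y => polyFun P (paramInv F y)) y‖ ≤ B * c₁⁻¹ := by
  have hK : IsOpen (F '' Q) := isOpen_image_param hc₁ hF hopen hQ hQc
  have hlim : ∀ y ∈ closure (F '' Q), ∃ z,
      Filter.Tendsto (gradient fun y => polyFun P (paramInv F y)) (𝓝[F '' Q] y) (𝓝 z) := by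
    intro y hy
    obtain ⟨G, hG, hGF⟩ := hsmooth
    refine exists_tendsto_gradient hK (h := fun y => polyFun P (G y)) ?_ ?_ hy
    · exact ((contDiff_polyFun P).of_le (by simp)).comp_contDiffOn (hG.of_le (by simp))
    · intro z hz
      simp only [hGF hz]
  refine ⟨continuousOn_extendFrom subset_rfl hlim, fun y hy => ?_⟩
  have : (𝓝[F '' Q] y).NeBot := mem_closure_iff_nhdsWithin_neBot.1 hy
  -- The bound passes to the limit, so it suffices inside the open element, where the chain rule
  -- applies.
  refine le_of_tendsto (tendsto_extendFrom (hlim y hy)).norm ?_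
  filter_upwards [self_mem_nhdsWithin] with z hz
  obtain ⟨x, hx, rfl⟩ := hz
  have hmem : F x ∈ F '' Q := ⟨x, hx, rfl⟩
  have hdiff := hsmooth.differentiableAt hK hmem
  have hinv := paramInv_apply (injOn_of_le_dist hc₁ hF) (hQc hx)
  have hP : DifferentiableAt ℝ (polyFun P) (paramInv F (F x)) :=
    (hasFDerivAt_polyFun P _).differentiableAt
  have hchain := (hP.hasFDerivAt.comp (F x) hdiff.hasFDerivAt).fderiv
  have hnorm : ‖fderiv ℝ (paramInv F) (F x)‖ ≤ c₁⁻¹ := by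
    have := norm_fderiv_le_of_lipschitzOn ℝ (hopen.mem_nhds ⟨x, hQc hx, rfl⟩)
      (lipschitzOnWith_paramInv hc₁ hF)
    rwa [Real.coe_toNNReal _ (inv_nonneg.2 hc₁.le)] at this
  rw [norm_gradient]
  change ‖fderiv ℝ (polyFun P ∘ paramInv F) (F x)‖ ≤ _
  rw [hchain, hinv]
  refine (ContinuousLinearMap.opNorm_comp_le _ _).trans ?_
  have hBx := hB x hx
  rw [norm_gradient] at hBx
  exact mul_le_mul hBx hnorm (norm_nonneg _) ((norm_nonneg _).trans hBx)

/-- If `v ∘ F` is a polynomial on an open set `A`, then the gradient of the polynomial is bounded by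
the gradient of `v`. -/
theorem norm_fderiv_polyFun_le (hc₁ : 0 < c₁) (hc₂ : 0 < c₂)
    (hF : ∀ x ∈ cube d, ∀ y ∈ cube d, c₁ * dist x y ≤ dist (F x) (F y))
    (hF' : ∀ x ∈ cube d, ∀ y ∈ cube d, dist (F x) (F y) ≤ c₂ * dist x y)
    (hopen : IsOpen (F '' cube d)) {A : Set (Pt d)} (hA : IsOpen A) (hAc : A ⊆ cube d)
    {P : MvPolynomial (Fin d) ℝ} {v : Pt d → ℝ} (hPv : ∀ x ∈ A, polyFun P x = v (F x))
    {x : Pt d} (hx : x ∈ A) (hFx : DifferentiableAt ℝ F x)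
    (hFy : DifferentiableAt ℝ (paramInv F) (F x)) :
    ‖fderiv ℝ (polyFun P) x‖ ≤ ‖gradient v (F x)‖ * c₂ := by
  have hinj := injOn_of_le_dist hc₁ hF
  -- Near `F x`, in the open set `F '' A`, the function `v` is the push-forward of `P`.
  have hv : DifferentiableAt ℝ v (F x) := by
    have h1 : DifferentiableAt ℝ (polyFun P ∘ paramInv F) (F x) :=
      (hasFDerivAt_polyFun P _).differentiableAt.comp _ hFy
    refine h1.congr_of_eventuallyEq (Filter.eventuallyEq_of_mem
      ((isOpen_image_param hc₁ hF hopen hA hAc).mem_nhds ⟨x, hx, rfl⟩) ?_)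
    rintro _ ⟨y, hy, rfl⟩
    rw [Function.comp_apply, paramInv_apply hinj (hAc hy), hPv y hy]
  have heq : polyFun P =ᶠ[𝓝 x] v ∘ F :=
    Filter.eventuallyEq_of_mem (hA.mem_nhds hx) fun y hy => hPv y hy
  rw [heq.fderiv_eq, (hv.hasFDerivAt.comp x hFx.hasFDerivAt).fderiv, norm_gradient]
  refine (ContinuousLinearMap.opNorm_comp_le _ _).trans ?_
  gcongr
  have := norm_fderiv_le_of_lipschitzOn ℝ ((isOpen_cube d).mem_nhds (hAc hx))
    (lipschitzOnWith_param hc₂ hF')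
  rwa [Real.coe_toNNReal _ hc₂.le] at this

/-- The `L²` norm of the gradient of `v` on the donor controls the gradient of the polynomial that
extends `v ∘ F`, at a point at a bounded relative distance. -/
theorem ofReal_norm_gradient_le_eLpNorm (hc₁ : 0 < c₁) (hc₂ : 0 < c₂)
    (hF : ∀ x ∈ cube d, ∀ y ∈ cube d, c₁ * dist x y ≤ dist (F x) (F y))
    (hF' : ∀ x ∈ cube d, ∀ y ∈ cube d, dist (F x) (F y) ≤ c₂ * dist x y)
    (hopen : IsOpen (F '' cube d)) {A T : Set (Pt d)} (hA : IsOpen A) (hAc : A ⊆ cube d)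
    (hAT : F '' A ⊆ T)
    (hFA : ∀ x ∈ A, DifferentiableAt ℝ F x ∧ DifferentiableAt ℝ (paramInv F) (F x))
    {P : MvPolynomial (Fin d) ℝ} {v : Pt d → ℝ} (hPv : ∀ x ∈ A, polyFun P x = v (F x))
    {ε m : ℝ} (hε : 0 < ε) {x : Pt d}
    (hvol : ∀ w, polyFun (polyDirDeriv P w) x ≠ 0 → ENNReal.ofReal m ≤
      volume {y ∈ A | ε * |polyFun (polyDirDeriv P w) x| < |polyFun (polyDirDeriv P w) y|}) :
    ENNReal.ofReal (‖gradient (polyFun P) x‖ * (ε / c₂) * √(c₁ ^ d * m)) ≤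
      eLpNorm (gradient v) 2 (volume.restrict T) := by
  -- Along its own gradient `w`, the derivative of `P` at `x` is `‖w‖ ^ 2`. So a lower bound for
  -- this single scalar polynomial controls the full gradient after division by `‖w‖`.
  set w := gradient (polyFun P) x
  rcases eq_or_ne w 0 with hw | hw
  · simp [hw]
  have hwx : polyFun (polyDirDeriv P w) x = ‖w‖ ^ 2 := by
    rw [polyFun_polyDirDeriv, ← inner_gradient_left, real_inner_self_eq_norm_sq]
  have hw0 : 0 < ‖w‖ := norm_pos_iff.2 hw
  have hS := hvol w (by rw [hwx]; positivity)
  rw [hwx, abs_of_nonneg (by positivity)] at hS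
  set S := {y ∈ A | ε * ‖w‖ ^ 2 < |polyFun (polyDirDeriv P w) y|}
  have hSo : IsOpen S :=
    hA.inter (isOpen_lt continuous_const (continuous_polyFun _).abs)
  have hSA : S ⊆ A := fun y hy => hy.1
  refine ofReal_mul_sqrt_le_eLpNorm
    (isOpen_image_param hc₁ hF hopen hSo (hSA.trans hAc)).measurableSet
    ((image_mono hSA).trans hAT) (by positivity) ?_ ?_
  · rintro _ ⟨y, hy, rfl⟩
    have h1 := norm_fderiv_polyFun_le hc₁ hc₂ hF hF' hopen hA hAc hPv hy.1 (hFA y hy.1).1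
      (hFA y hy.1).2
    have h2 : ε * ‖w‖ ^ 2 < ‖fderiv ℝ (polyFun P) y‖ * ‖w‖ := by
      refine hy.2.trans_le ?_
      rw [polyFun_polyDirDeriv]
      exact (fderiv ℝ (polyFun P) y).le_opNorm w
    rw [mul_div_assoc', div_le_iff₀ hc₂]
    refine le_trans ?_ h1
    refine le_of_mul_le_mul_right ?_ hw0
    calc ‖w‖ * ε * ‖w‖ = ε * ‖w‖ ^ 2 := by ring
      _ ≤ _ := h2.le
  · have h1 := hS.trans (volume_le_volume_image hc₁ hF (hSA.trans hAc))
    rw [ENNReal.ofReal_mul (by positivity)]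
    refine (mul_le_mul_right h1 _).trans ?_
    rw [← mul_assoc, ← ENNReal.ofReal_mul (by positivity), ← mul_pow, mul_inv_cancel₀ hc₁.ne',
      one_pow, ENNReal.ofReal_one, one_mul]

theorem diam_image_le (hc₂ : 0 < c₂)
    (hF' : ∀ x ∈ cube d, ∀ y ∈ cube d, dist (F x) (F y) ≤ c₂ * dist x y) {Q : Set (Pt d)}
    (hQ : Bornology.IsBounded Q) (hQc : Q ⊆ cube d) :
    Metric.diam (F '' Q) ≤ c₂ * Metric.diam Q := by
  refine Metric.diam_le_of_forall_dist_le (mul_nonneg hc₂.le Metric.diam_nonneg) ?_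
  rintro _ ⟨x, hx, rfl⟩ _ ⟨y, hy, rfl⟩
  exact (hF' x (hQc hx) y (hQc hy)).trans
    (mul_le_mul_of_nonneg_left (Metric.dist_le_diam_of_mem hQ hx hy) hc₂.le)

/-- Neighbouring physical elements have neighbouring parametric elements. -/
theorem exists_dist_lt_of_setDist_le (hc₁ : 0 < c₁) (hc₂ : 0 < c₂)
    (hF : ∀ x ∈ cube d, ∀ y ∈ cube d, c₁ * dist x y ≤ dist (F x) (F y))
    (hF' : ∀ x ∈ cube d, ∀ y ∈ cube d, dist (F x) (F y) ≤ c₂ * dist x y) {Q Q' : Set (Pt d)}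
    (hQ : Bornology.IsBounded Q) (hQc : Q ⊆ cube d) (hQc' : Q' ⊆ cube d) (hne : Q.Nonempty)
    (hne' : Q'.Nonempty) (hpos : 0 < Metric.diam Q) {c : ℝ} (hc : 0 ≤ c)
    (hdist : setDist (F '' Q) (F '' Q') ≤ c * Metric.diam (F '' Q)) :
    ∃ a ∈ Q, ∃ b ∈ Q', dist a b ≤ (c + 1) * c₂ / c₁ * Metric.diam Q := by
  -- The constant `c + 1` in place of `c` makes the inequality strict, so some actual pair of points
  -- satisfies it although the infimum need not be attained.
  have h1 : setDist (F '' Q) (F '' Q') < (c + 1) * (c₂ * Metric.diam Q) := by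
    refine hdist.trans_lt ?_
    have := mul_le_mul_of_nonneg_left (diam_image_le hc₂ hF' hQ hQc) hc
    have := mul_pos hc₂ hpos
    linarith
  obtain ⟨a₀, ha₀⟩ := hne
  obtain ⟨b₀, hb₀⟩ := hne'
  obtain ⟨_, ⟨_, ⟨a, ha, rfl⟩, _, ⟨b, hb, rfl⟩, rfl⟩, hlt⟩ := exists_lt_of_csInf_lt
    (⟨_, F a₀, ⟨a₀, ha₀, rfl⟩, F b₀, ⟨b₀, hb₀, rfl⟩, rfl⟩ :
      {r | ∃ a ∈ F '' Q, ∃ b ∈ F '' Q', r = dist a b}.Nonempty) h1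
  refine ⟨a, ha, b, hb, ?_⟩
  have h2 := (hF a (hQc ha) b (hQc' hb)).trans hlt.le
  rw [div_mul_eq_mul_div, le_div_iff₀ hc₁]
  linarith

end Estimates

end TrimmedIGA

/-! ### The stabilization estimate -/

theorem mainTheorem2 (d : ℕ) (hd : d = 2 ∨ d = 3) (p₀ p : ℕ) (hp₀ : 1 ≤ p₀) (hp : 1 ≤ p)
    (Ξ₀ : Fin d → KnotVector p₀) (F : Pt d → Pt d) (hF : IsParametrization Ξ₀ F)
    (σ cΓ cN θ : ℝ) (hθ : 0 < θ) (hθ' : θ ≤ 1) :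
    ∃ C : ℝ≥0, 0 < C ∧
      ∀ Ξ : Fin d → KnotVector p, splineSpace Ξ₀ ≤ splineSpace Ξ → ElementwiseSmooth F Ξ →
        ShapeRegular σ Ξ →
      ∀ Ω Ω₁ ΓD : Set (Pt d), IsOpen Ω₁ → IsConnected Ω₁ → Bornology.IsBounded Ω₁ →
        Ω = trimmedDomain F Ω₁ → IsLipschitzDomain Ω →
        ΓD ⊆ frontier Ω → MeasurableSet ΓD → BoundedDirichletParts cΓ F Ξ Ω ΓD →
      ∀ s : Set (Pt d) → Set (Pt d), IsGoodNeighbourChoice cN θ F Ξ Ω s →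
      ∀ Q ∈ cutMesh F Ξ Ω Ω₁, ∀ v ∈ trimmedSpace F Ξ Ω,
        MemLp (stabilizedFlux p θ F Ω s v Q) 2 (μHE[d - 1].restrict (dirichletPart F ΓD Q)) ∧
        eLpNorm (fun x => Real.sqrt (Metric.diam (F '' Q)) * stabilizedFlux p θ F Ω s v Q x) 2
            (μHE[d - 1].restrict (dirichletPart F ΓD Q)) ≤
          C * eLpNorm (gradient v) 2 (volume.restrict (Ω ∩ F '' donor θ F Ω s Q)) := by
  obtain ⟨c₁, c₂, hc₁, hc₂, hlip⟩ := hF.biLipschitz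
  have hF₁ : ∀ x ∈ cube d, ∀ y ∈ cube d, c₁ * dist x y ≤ dist (F x) (F y) :=
    fun x hx y hy => (hlip x hx y hy).1
  have hF₂ : ∀ x ∈ cube d, ∀ y ∈ cube d, dist (F x) (F y) ≤ c₂ * dist x y :=
    fun x hx y hy => (hlip x hx y hy).2
  have hinj := injOn_of_le_dist hc₁ hF₁
  have hopen := hF.isOpen_image
  have hd2 : 2 ≤ d := by omega
  -- The given constants carry no sign; enlarging them to `σ'`, `κ` and `N` keeps the hypotheses in
  -- force.
  set σ' := max σ 1
  have hσ' : 0 < σ' := lt_max_of_lt_right one_pos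
  set κ := max cΓ 0
  have hκ : 0 ≤ κ := le_max_right _ _
  set N := max cN 0
  have hN : 0 ≤ N := le_max_right _ _
  -- A good element has the fraction `θ` inside, and its volume is at least `(h / σ') ^ d`.
  set τ := θ / σ' ^ d
  have hτ : 0 < τ := by positivity
  -- One diameter of `Q` to cross it, then the distance to the donor, both measured in `h` by
  -- quasi-uniformity; the final `1` is slack.
  set M := (1 + (N + 1) * c₂ / c₁) * σ' ^ 2 + 1
  obtain ⟨ε, hε, hsuper⟩ := exists_volume_superlevel_ge (d := d) (d * p) M hτ
  -- Up to the common factor `B * √(h ^ d)`, `a` is the upper bound for the weighted flux and `b`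
  -- the lower bound for the gradient on the donor.
  set a := c₁⁻¹ * √(κ * (c₂ * σ' ^ 2) ^ d)
  have ha : 0 ≤ a := by positivity
  set b := ε / c₂ * √(c₁ ^ d * (τ / 2))
  have hb : 0 < b := by positivity
  -- The added `1` keeps the constant positive when `κ = 0`, where `a` vanishes.
  refine ⟨Real.toNNReal (a / b + 1), by rw [Real.toNNReal_pos]; positivity, ?_⟩
  intro Ξ _ hsmooth hshape Ω Ω₁ ΓD _ _ _ hΩ hΩL _ hΓD hΓ s hs Q hQcut v hv
  have hshape' : ShapeRegular σ' Ξ := fun i hi l => (hshape i hi l).trans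
    (mul_le_mul_of_nonneg_right (le_max_left _ _) (sub_nonneg.2 (hi l).2.le))
  have hQact := hQcut.1
  obtain ⟨⟨i, hi, rfl⟩, -⟩ := id hQact
  set Q := cell Ξ i
  set Q' := donor θ F Ω s Q with hQ'
  have hdonor : Q' ∈ bezierMesh Ξ ∧ IsGood θ F Ω Q' ∧
      ∃ x ∈ Q, ∃ y ∈ Q', dist x y ≤ (N + 1) * c₂ / c₁ * Metric.diam Q := by
    obtain ⟨x₁, hx₁⟩ := cell_nonempty hi
    by_cases hgood : IsGood θ F Ω Q
    · have h1 : Q' = Q := by rw [hQ', donor, if_pos hgood]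
      rw [h1]
      refine ⟨hQact.1, hgood, x₁, hx₁, x₁, hx₁, ?_⟩
      rw [dist_self]
      exact mul_nonneg (by positivity) Metric.diam_nonneg
    · have h1 : Q' = s Q := by rw [hQ', donor, if_neg hgood]
      rw [h1]
      obtain ⟨⟨hact, -, hdist⟩, hgood'⟩ := hs Q hQact hgood
      obtain ⟨j, hj, hjQ⟩ := hact.1
      refine ⟨hact.1, hgood', exists_dist_lt_of_setDist_le hc₁ hc₂ hF₁ hF₂ (isBounded_cell Ξ i)
        (cell_subset_cube hi) (hjQ ▸ cell_subset_cube hj) ⟨x₁, hx₁⟩ (hjQ ▸ cell_nonempty hj)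
        ((sub_pos.2 (hi ⟨0, by omega⟩).2).trans_le (edge_le_diam_cell hi _)) hN
        (hdist.trans (mul_le_mul_of_nonneg_right (le_max_left _ _) Metric.diam_nonneg))⟩
  obtain ⟨⟨j, hj, hjQ⟩, hgood, x₁, hx₁, x₀, hx₀, hx₁₀⟩ := hdonor
  set h := Metric.diam Q'
  have hh : 0 < h := by
    simp only [h, hjQ]
    exact (sub_pos.2 (hj ⟨0, by omega⟩).2).trans_le (edge_le_diam_cell hj _)
  have hQh : Metric.diam Q ≤ σ' ^ 2 * h := by
    simp only [h, hjQ]; exact hshape'.diam_le hσ'.le hd2 hi hj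
  have hQ'o : IsOpen Q' := hjQ ▸ isOpen_cell Ξ j
  have hQ'b : Bornology.IsBounded Q' := hjQ ▸ isBounded_cell Ξ j
  have hQ'c : Q' ⊆ cube d := hjQ ▸ cell_subset_cube hj
  have hQo : IsOpen Q := isOpen_cell Ξ i
  have hQb : Bornology.IsBounded Q := isBounded_cell Ξ i
  have hQc : Q ⊆ cube d := cell_subset_cube hi
  -- the good part of the donor
  set A := pullback F Ω ∩ Q'
  have hAo : IsOpen A := by
    have h1 : pullback F Ω = cube d ∩ F ⁻¹' Ω := rfl
    simp only [A, h1]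
    exact ((lipschitzOnWith_param hc₂ hF₂).continuousOn.isOpen_inter_preimage (isOpen_cube d)
      hΩL.1).inter hQ'o
  have hAc : A ⊆ cube d := fun x hx => hx.1.1
  have hAvol : ENNReal.ofReal (τ * h ^ d) ≤ volume A := by
    have h1 := hshape'.pow_le_volume hσ' hj
    rw [← hjQ] at h1
    have hfin : volume Q' ≠ ⊤ := hQ'b.measure_lt_top.ne
    have h2 : (h / σ') ^ d ≤ volume.real Q' := (ENNReal.ofReal_le_iff_le_toReal hfin).1 h1
    have h3 : θ * volume.real Q' ≤ volume.real A :=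
      (le_div_iff₀ (lt_of_lt_of_le (by positivity) h2)).1 hgood
    refine ENNReal.ofReal_le_of_le_toReal (le_trans ?_ h3)
    calc τ * h ^ d = θ * (h / σ') ^ d := by simp only [τ]; rw [div_pow]; ring
      _ ≤ _ := by gcongr
  have hAball : A ⊆ Metric.closedBall x₀ h := fun x hx =>
    Metric.dist_le_diam_of_mem hQ'b hx.2 hx₀
  -- the polynomial
  obtain ⟨hPdeg, hPv⟩ := polyExtension_spec (p := p) (A := A) (w := fun x => v (F x)) (by
    have := exists_polyFun_eq_trimmed hinj Ξ (Ω := Ω) hj hv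
    rwa [← hjQ] at this)
  set P := polyExtension p A fun x => v (F x) with hPdef
  have hgradc : Continuous fun x => ‖gradient (polyFun P) x‖ := by
    simp_rw [norm_gradient]
    exact ((contDiff_polyFun P).continuous_fderiv (by simp)).norm
  -- The maximum is taken over the closure of `Q`, where the flux lives, although `P` is determined
  -- by `v` on the donor.
  obtain ⟨x, hx, hxmax⟩ := hQb.isCompact_closure.exists_isMaxOn ⟨x₁, subset_closure hx₁⟩
    hgradc.continuousOn
  set B := ‖gradient (polyFun P) x‖
  have hB : 0 ≤ B := norm_nonneg _
  have hxx₀ : dist x x₀ ≤ M * h := by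
    have h1 : dist x x₁ ≤ Metric.diam Q := by
      rw [← Metric.diam_closure]
      exact Metric.dist_le_diam_of_mem hQb.closure hx (subset_closure hx₁)
    calc dist x x₀ ≤ dist x x₁ + dist x₁ x₀ := dist_triangle _ _ _
      _ ≤ Metric.diam Q + (N + 1) * c₂ / c₁ * Metric.diam Q := add_le_add h1 hx₁₀
      _ = (1 + (N + 1) * c₂ / c₁) * Metric.diam Q := by ring
      _ ≤ (1 + (N + 1) * c₂ / c₁) * (σ' ^ 2 * h) := by gcongr
      _ ≤ M * h := by simp only [M]; linarith
  have hlower := ofReal_norm_gradient_le_eLpNorm (T := Ω ∩ F '' Q') hc₁ hc₂ hF₁ hF₂ hopen hAo hAc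
    (by rintro _ ⟨y, hy, rfl⟩; exact ⟨hy.1.2, y, hy.2, rfl⟩)
    (fun y hy => ⟨(hsmooth Q' ⟨j, hj, hjQ⟩).1.differentiableAt hQ'o hy.2,
      (hsmooth Q' ⟨j, hj, hjQ⟩).2.differentiableAt
        (isOpen_image_param hc₁ hF₁ hopen hQ'o hQ'c) ⟨y, hy.2, rfl⟩⟩)
    hPv hε (m := τ / 2 * h ^ d) (x := x) (fun w hw => hsuper _
      ((totalDegree_polyDirDeriv_le P w).trans (totalDegree_le_of_mem_restrictDegree hPdeg))
      x₀ x h hh hxx₀ hw A hAball hAvol)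
  -- the flux
  obtain ⟨hcont, hbound⟩ := continuousOn_extendFrom_gradient hc₁ hF₁ hopen hQo hQc
    (hsmooth Q hQact.1).2 P fun y hy => hxmax (subset_closure hy)
  set Γ := dirichletPart F ΓD Q
  have hΓm : MeasurableSet Γ := hΓD.inter isClosed_closure.measurableSet
  set H := Metric.diam (F '' Q)
  have hH : 0 ≤ H := Metric.diam_nonneg
  have hHh : H ≤ c₂ * σ' ^ 2 * h := by
    refine (diam_image_le hc₂ hF₂ hQb hQc).trans ?_
    rw [mul_assoc]
    gcongr
  have hmeas : AEStronglyMeasurable (stabilizedFlux p θ F Ω s v Q) (μHE[d - 1].restrict Γ) :=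
    (((hcont.aestronglyMeasurable isClosed_closure.measurableSet).mono_measure
      (Measure.restrict_mono inter_subset_right le_rfl)).inner
        (measurable_outwardNormal Ω).aestronglyMeasurable)
  have hfb : ∀ᵐ y ∂(μHE[d - 1].restrict Γ), ‖stabilizedFlux p θ F Ω s v Q y‖ ≤ B * c₁⁻¹ := by
    filter_upwards [ae_restrict_mem hΓm] with y hy
    refine (norm_inner_le_norm _ _).trans ?_
    refine (mul_le_mul (hbound y hy.2) (norm_outwardNormal_le Ω y) (norm_nonneg _)
      (by positivity)).trans_eq (mul_one _)
  have hμ : (μHE[d - 1].restrict Γ) univ ≤ ENNReal.ofReal (κ * H ^ (d - 1)) := by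
    rw [Measure.restrict_apply_univ]
    rcases Γ.eq_empty_or_nonempty with h0 | h0
    · simp [h0]
    · refine (hΓ Q hQact h0).trans (ENNReal.ofReal_le_ofReal ?_)
      exact mul_le_mul_of_nonneg_right (le_max_left _ _) (pow_nonneg hH _)
  refine ⟨⟨hmeas, (eLpNorm_le_ofReal_mul_sqrt (by positivity) (by positivity) hfb hμ).trans_lt
    ENNReal.ofReal_lt_top⟩, ?_⟩
  refine (eLpNorm_le_ofReal_mul_sqrt (c := √H * (B * c₁⁻¹)) (by positivity) (by positivity) ?_
    hμ).trans ?_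
  · filter_upwards [hfb] with y hy
    rw [norm_mul, Real.norm_of_nonneg (Real.sqrt_nonneg _)]
    gcongr
  refine le_trans ?_ (mul_le_mul_right hlower _)
  rw [← ENNReal.ofReal, ← ENNReal.ofReal_mul (by positivity)]
  refine ENNReal.ofReal_le_ofReal ?_
  -- The weight `√H` supplies the missing power, `H * H ^ (d - 1) = H ^ d`, matching the volume
  -- scaling of the lower bound.
  have h1 : √H * √(κ * H ^ (d - 1)) ≤ √(κ * (c₂ * σ' ^ 2) ^ d) * √(h ^ d) := by
    rw [← Real.sqrt_mul hH, ← Real.sqrt_mul (by positivity)]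
    refine Real.sqrt_le_sqrt ?_
    calc H * (κ * H ^ (d - 1)) = κ * H ^ (d - 1 + 1) := by ring
      _ = κ * H ^ d := by rw [Nat.sub_add_cancel (by omega)]
      _ ≤ κ * (c₂ * σ' ^ 2 * h) ^ d := by gcongr
      _ = _ := by ring
  have h2 : √(c₁ ^ d * (τ / 2 * h ^ d)) = √(c₁ ^ d * (τ / 2)) * √(h ^ d) := by
    rw [← Real.sqrt_mul (by positivity), mul_assoc]
  calc √H * (B * c₁⁻¹) * √(κ * H ^ (d - 1)) = B * c₁⁻¹ * (√H * √(κ * H ^ (d - 1))) := by ring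
    _ ≤ B * c₁⁻¹ * (√(κ * (c₂ * σ' ^ 2) ^ d) * √(h ^ d)) := by gcongr
    _ = a / b * (B * (b * √(h ^ d))) := by simp only [a]; field_simp
    _ ≤ (a / b + 1) * (B * (b * √(h ^ d))) := by gcongr; linarith
    _ = (a / b + 1) * (B * (ε / c₂) * √(c₁ ^ d * (τ / 2 * h ^ d))) := by
      rw [h2]; simp only [b]; ring
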